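/- Let $X$ be a locally compact Polish space with Borel $\sigma$-algebra $\mathcal B(X)$, let $\mathbb R_+^*=(0,\infty)$ and $\mathbb X=\mathbb R_+^*\times X$. Let $\mathbb K(X)$ be the set of nonnegative Radon measures on $X$ of the form $\eta=\sum_i s_i\delta_{x_i}$ (an at most countable sum, $s_i>0$, $x_i\in X$ distinct), with the Borel $\sigma$-algebra of the vague topology; for $\eta\in\mathbb K(X)$ put $s_x=\eta(\{x\})$ and $\tau(\eta)=\{x:s_x>0\}$. Let $\Gamma(\mathbb X)$ be the space of sets $\gamma\subset\mathbb X$ such that $\gamma\cap([a,b]\times\Lambda)$ is finite for all $0<a<b<\infty$ and all relatively compact Borel $\Lambda\subset X$; identify $\gamma$ with $\sum_{y\in\gamma}\delta_y$ and equip $\Gamma(\mathbb X)$ with the Borel $\sigma$-algebra of the vague topology. Let $\Pi(\mathbb X)$ be the set of $\gamma\in\Gamma(\mathbb X)$ such that distinct points of $\gamma$ have distinct $X$-coordinates and $\sum_{(s,x)\in\gamma}s\,\mathbf 1_\Lambda(x)<\infty$ for all relatively compact Borel $\Lambda$. The map $\mathcal R:\Pi(\mathbb X)\to\mathbb K(X)$,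 $\mathcal R(\gamma)=\sum_{(s,x)\in\gamma}s\delta_x$, is a bijection. Let $\nu$ and $\sigma$ be non-atomic positive Radon measures on $\mathbb R_+^*$ and $X$, respectively, with $\int_{\mathbb R_+^*}s\,d\nu(s)<\infty$. Let $\pi_{\nu\otimes\sigma}$ be the Poisson measure on $\Gamma(\mathbb X)$ with intensity $\nu\otimes\sigma$, that is, the probability measure under which the numbers $|\gamma\cap A|$ for finitely many pairwise disjoint relatively compact Borel sets $A\subset\mathbb X$ are independent and Poisson distributed with parameters $(\nu\otimes\sigma)(A)$. It is carried by $\Pi(\mathbb X)$; let $\pi_{\mathbb K,\nu\otimes\sigma}$ be its image on $\mathbb K(X)$ under $\mathcal R$. Let $\mathcal F$ be the set of functions $F:\mathbb K(X)\to\mathbb R$ of the form $F(\eta)=g(\langle\mathcal R^{-1}\eta,\varphi_1\rangle,\dots,\langle\mathcal R^{-1}\eta,\varphi_N\rangle)$ with $N\in\mathbb N$, $g\in C_{\mathrm b}(\mathbb R^N)$ and $\varphi_1,\dots,\varphi_N\in C_{\mathrm c}(\mathbb X)$. For $F\in\mathcal F$ and $h\in C_{\mathrm c}(X)$ put $$(D_h^-F)(\eta)=\int_X\bigl(F(\eta-s_x\delta_x)-F(\eta)\bigr)h(x)\,d\eta(x),$$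 $$(D_h^+F)(\eta)=\int_X\int_{\mathbb R_+^*}\bigl(F(\eta+s\delta_x)-F(\eta)\bigr)\,s\,d\nu(s)\,h(x)\,d\sigma(x),$$ $$B_{\nu,\sigma,h}(\eta)=\int_Xh\,d\eta-\int_{\mathbb R_+^*}s\,d\nu(s)\int_Xh\,d\sigma .$$ Then for all $F,G\in\mathcal F$ and $h\in C_{\mathrm c}(X)$, the integrals defining $(D_h^-F)(\eta)$ and $(D_h^+G)(\eta)$ converge absolutely for every $\eta\in\mathbb K(X)$, the functions $(D_h^-F)G$, $F\,(D_h^+G)$ and $FG\,B_{\nu,\sigma,h}$ are $\pi_{\mathbb K,\nu\otimes\sigma}$-integrable, and $$\int_{\mathbb K(X)}(D_h^-F)\,G\,d\pi_{\mathbb K,\nu\otimes\sigma}=\int_{\mathbb K(X)}F\,(D_h^+G)\,d\pi_{\mathbb K,\nu\otimes\sigma}-\int_{\mathbb K(X)}F\,G\,B_{\nu,\sigma,h}\,d\pi_{\mathbb K,\nu\otimes\sigma}.$$ -/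

import Mathlib

open MeasureTheory ProbabilityTheory Set
open scoped ENNReal CompactlySupported BoundedContinuousFunction

namespace RadonCone

/-- The half-line `(0, ∞)` of weights. Its usual topology is that of the logarithmic metric. -/
abbrev Weight : Type := Set.Ioi (0 : ℝ)

/-- The space `(0, ∞) × X` of pairs (weight, position). -/
abbrev Marked (X : Type*) : Type _ := Weight × X

/-- The vague topology on a set `α` of measures on `Y` (embedded by `m`): the coarsest topology
for which `a ↦ ∫ f d(m a)` is continuous for every continuous compactly supported `f`. -/
noncomputable abbrev vagueTopology {α Y : Type*} [TopologicalSpace Y] [MeasurableSpace Y]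
    (m : α → Measure Y) : TopologicalSpace α :=
  ⨅ f : C_c(Y, ℝ), TopologicalSpace.induced (fun a => ∫ y, f y ∂(m a)) inferInstance

/-- The measure `∑_{(s, x) ∈ S} s δ_x`. -/
noncomputable def markedMeasure {X : Type*} [MeasurableSpace X] (S : Set (Marked X)) :
    Measure X :=
  Measure.sum fun y : S => ENNReal.ofReal (y.1.1 : ℝ) • Measure.dirac y.1.2

/-- The set of pairs `(s, x)` with `η {x} = s > 0`. -/
def atomSet {X : Type*} [MeasurableSpace X] (η : Measure X) : Set (Marked X) :=
  {y | η {y.2} = ENNReal.ofReal (y.1 : ℝ)}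

/-- Nonnegative Radon measures of the form `∑ s_i δ_{x_i}`, with an at most countable family of
weights `s_i > 0` and distinct points `x_i`. On a locally compact Polish space, a nonnegative Borel
measure is Radon if and only if it is locally finite. -/
def IsDiscreteRadon {X : Type*} [TopologicalSpace X] [MeasurableSpace X] (η : Measure X) : Prop :=
  IsLocallyFiniteMeasure η ∧
    ∃ S : Set (Marked X), S.Countable ∧ Set.InjOn Prod.snd S ∧ η = markedMeasure S

/-- The cone `𝕂(X)` of nonnegative discrete Radon measures on `X`. -/
def Cone (X : Type*) [TopologicalSpace X] [MeasurableSpace X] : Type _ :=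
  {η : Measure X // IsDiscreteRadon η}

/-- The cone carries the vague topology. -/
noncomputable instance instTopologicalSpaceCone (X : Type*) [TopologicalSpace X]
    [MeasurableSpace X] : TopologicalSpace (Cone X) :=
  vagueTopology fun η : Cone X => η.1

/-- The cone carries the Borel `σ`-algebra of the vague topology. -/
noncomputable instance instMeasurableSpaceCone (X : Type*) [TopologicalSpace X]
    [MeasurableSpace X] : MeasurableSpace (Cone X) :=
  borel (Cone X)

/-- The space `Γ((0, ∞) × X)` of locally finite configurations. -/
def Config (X : Type*) [TopologicalSpace X] [MeasurableSpace X] : Type _ :=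
  {γ : Set (Marked X) // ∀ (a b : Weight) (Λ : Set X), a < b → MeasurableSet Λ →
    IsCompact (closure Λ) → (γ ∩ (Set.Icc a b ×ˢ Λ)).Finite}

/-- A configuration `γ` is identified with the measure `∑_{y ∈ γ} δ_y`. -/
noncomputable def Config.toMeasure {X : Type*} [TopologicalSpace X] [MeasurableSpace X]
    (γ : Config X) : Measure (Marked X) :=
  Measure.sum fun y : γ.1 => Measure.dirac y.1

/-- The configuration space carries the vague topology. -/
noncomputable instance instTopologicalSpaceConfig (X : Type*) [TopologicalSpace X]
    [MeasurableSpace X] : TopologicalSpace (Config X) :=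
  vagueTopology fun γ : Config X => γ.toMeasure

/-- The configuration space carries the Borel `σ`-algebra of the vague topology. -/
noncomputable instance instMeasurableSpaceConfig (X : Type*) [TopologicalSpace X]
    [MeasurableSpace X] : MeasurableSpace (Config X) :=
  borel (Config X)

/-- The number `|γ ∩ A|`; it is used for relatively compact `A`, where it is finite. -/
noncomputable def Config.count {X : Type*} [TopologicalSpace X] [MeasurableSpace X]
    (A : Set (Marked X)) (γ : Config X) : ℕ :=
  (γ.1 ∩ A).ncard

/-- The local mass `∑_{(s, x) ∈ γ} s 1_Λ(x)`. -/
noncomputable def Config.localMass {X : Type*} [TopologicalSpace X] [MeasurableSpace X]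
    (γ : Config X) (Λ : Set X) : ℝ≥0∞ :=
  ∑' y : γ.1, Λ.indicator (fun _ => ENNReal.ofReal (y.1.1 : ℝ)) y.1.2

/-- `π` is the Poisson measure with intensity `m`: the numbers of points in disjoint relatively
compact Borel sets `A` are independent and Poisson distributed with parameters `m A`. -/
structure IsPoisson {X : Type*} [TopologicalSpace X] [MeasurableSpace X]
    (m : Measure (Marked X)) (π : Measure (Config X)) : Prop where
  isProbabilityMeasure : IsProbabilityMeasure π
  map_count : ∀ A : Set (Marked X), MeasurableSet A → IsCompact (closure A) →
    π.map (Config.count A) = poissonMeasure (m A).toNNReal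
  iIndepFun_count : ∀ (n : ℕ) (A : Fin n → Set (Marked X)), (∀ i, MeasurableSet (A i)) →
    (∀ i, IsCompact (closure (A i))) → Pairwise (fun i j => Disjoint (A i) (A j)) →
    iIndepFun (fun i => Config.count (A i)) π

/-- The set `Π((0, ∞) × X)` of pinpointing configurations with finite local mass. -/
def pinpointing (X : Type*) [TopologicalSpace X] [MeasurableSpace X] : Set (Config X) :=
  {γ | Set.InjOn Prod.snd γ.1 ∧
    ∀ Λ : Set X, MeasurableSet Λ → IsCompact (closure Λ) → γ.localMass Λ < ∞}

section Basic

variable {X : Type*} [TopologicalSpace X] [MeasurableSpace X]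

theorem markedMeasure_apply (S : Set (Marked X)) {A : Set X} (hA : MeasurableSet A) :
    markedMeasure S A = ∑' y : S, A.indicator (fun _ => ENNReal.ofReal (y.1.1 : ℝ)) y.1.2 := by
  rw [markedMeasure, Measure.sum_apply _ hA]
  refine tsum_congr fun y => ?_
  by_cases h : y.1.2 ∈ A <;> simp [Measure.dirac_apply' _ hA, h]

theorem markedMeasure_singleton [MeasurableSingletonClass X] {S : Set (Marked X)}
    (hS : Set.InjOn Prod.snd S) {y : Marked X} (hy : y ∈ S) :
    markedMeasure S {y.2} = ENNReal.ofReal (y.1 : ℝ) := by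
  rw [markedMeasure_apply S (measurableSet_singleton _), tsum_eq_single ⟨y, hy⟩]
  · simp
  · intro z hz
    apply Set.indicator_of_notMem
    intro h
    exact hz (Subtype.ext (hS z.2 hy h))

theorem exists_mem_of_markedMeasure_ne_zero [MeasurableSingletonClass X] {S : Set (Marked X)}
    {x : X} (h : markedMeasure S {x} ≠ 0) : ∃ y ∈ S, y.2 = x := by
  by_contra! hc
  apply h
  rw [markedMeasure_apply S (measurableSet_singleton _), ENNReal.tsum_eq_zero]
  intro y
  exact Set.indicator_of_notMem (s := {x}) (hc y.1 y.2) _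

theorem ofReal_weight_ne_zero (s : Weight) : ENNReal.ofReal (s : ℝ) ≠ 0 := by
  have h : (0 : ℝ) < s := s.2
  exact (ENNReal.ofReal_pos.2 h).ne'

theorem ofReal_weight_inj {s t : Weight}
    (h : ENNReal.ofReal (s : ℝ) = ENNReal.ofReal (t : ℝ)) : s = t :=
  Subtype.ext ((ENNReal.ofReal_eq_ofReal_iff (le_of_lt s.2) (le_of_lt t.2)).1 h)

theorem atomSet_markedMeasure [MeasurableSingletonClass X] {S : Set (Marked X)}
    (hS : Set.InjOn Prod.snd S) : atomSet (markedMeasure S) = S := by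
  ext y
  constructor
  · intro hy
    obtain ⟨z, hz, hzy⟩ := exists_mem_of_markedMeasure_ne_zero (S := S) (x := y.2) (by
      rw [show markedMeasure S {y.2} = _ from hy]; exact ofReal_weight_ne_zero _)
    have h1 := markedMeasure_singleton hS hz
    rw [hzy, show markedMeasure S {y.2} = _ from hy] at h1
    have : y = z := Prod.ext (ofReal_weight_inj h1) hzy.symm
    rwa [this]
  · intro hy
    exact markedMeasure_singleton hS hy

theorem injOn_atomSet (η : Measure X) : Set.InjOn Prod.snd (atomSet η) := by
  intro y hy z hz h
  refine Prod.ext (ofReal_weight_inj ?_) h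
  rw [← show η {y.2} = _ from hy, ← show η {z.2} = _ from hz, h]

theorem Cone.markedMeasure_atomSet [MeasurableSingletonClass X] (η : Cone X) :
    markedMeasure (atomSet η.1) = η.1 := by
  obtain ⟨S, -, hS, h⟩ := η.2.2
  rw [h, atomSet_markedMeasure hS]

/-- A locally finite measure carried by a countable set belongs to the cone. -/
theorem isDiscreteRadon_of_countable [MeasurableSingletonClass X] {η : Measure X}
    [IsLocallyFiniteMeasure η] {C : Set X} (hC : C.Countable) (h : η Cᶜ = 0) :
    IsDiscreteRadon η := by
  have hcount : (atomSet η).Countable := by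
    have hsub : Set.MapsTo Prod.snd (atomSet η) C := by
      intro y hy
      by_contra hyC
      have h0 : η {y.2} = 0 := measure_mono_null (by simpa using hyC) h
      rw [show η {y.2} = _ from hy] at h0
      exact ofReal_weight_ne_zero _ h0
    exact Set.MapsTo.countable_of_injOn hsub (injOn_atomSet η) hC
  refine ⟨inferInstance, atomSet η, hcount, injOn_atomSet η, ?_⟩
  have hsing : ∀ x, markedMeasure (atomSet η) {x} = η {x} := by
    intro x
    by_cases hx : η {x} = 0
    · rw [hx]
      by_contra hne
      obtain ⟨y, hy, rfl⟩ := exists_mem_of_markedMeasure_ne_zero hne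
      rw [show η {y.2} = _ from hy] at hx
      exact ofReal_weight_ne_zero _ hx
    · have hfin : η {x} ≠ ∞ := (isCompact_singleton.measure_lt_top).ne
      have hmem : ((⟨(η {x}).toReal, ENNReal.toReal_pos hx hfin⟩, x) : Marked X) ∈ atomSet η :=
        (ENNReal.ofReal_toReal hfin).symm
      have h2 := markedMeasure_singleton (injOn_atomSet η) hmem
      exact h2.trans (ENNReal.ofReal_toReal hfin)
  have hC' : markedMeasure (atomSet η) Cᶜ = 0 := by
    rw [markedMeasure_apply _ hC.measurableSet.compl, ENNReal.tsum_eq_zero]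
    intro y
    by_contra hne
    have hy : y.1.2 ∈ Cᶜ := Set.mem_of_indicator_ne_zero hne
    have h0 : η {y.1.2} = 0 := measure_mono_null (by simpa using hy) h
    rw [show η {y.1.2} = _ from y.2] at h0
    exact ofReal_weight_ne_zero _ h0
  ext A hA
  have key : ∀ m : Measure X, m Cᶜ = 0 → m A = ∑' x : ↥(A ∩ C), m {x.1} := by
    intro m hm
    have hcA : (A ∩ C).Countable := hC.mono Set.inter_subset_right
    have h1 : m A = m (A ∩ C) :=
      (measure_inter_conull hm).symm
    rw [h1, ← measure_biUnion hcA (fun x _ y _ hxy => by simpa using hxy)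
      (fun x _ => measurableSet_singleton x)]
    rw [Set.biUnion_of_singleton]
  rw [key η h, key _ hC']
  exact tsum_congr fun x => (hsing x.1).symm

theorem IsDiscreteRadon.exists_countable {η : Measure X} [MeasurableSingletonClass X]
    (h : IsDiscreteRadon η) : ∃ C : Set X, C.Countable ∧ η Cᶜ = 0 := by
  obtain ⟨-, S, hSc, -, rfl⟩ := h
  refine ⟨Prod.snd '' S, hSc.image _, ?_⟩
  rw [markedMeasure_apply _ (hSc.image _).measurableSet.compl, ENNReal.tsum_eq_zero]
  intro y
  apply Set.indicator_of_notMem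
  exact fun hy => hy ⟨y.1, y.2, rfl⟩

end Basic

section Space

variable {X : Type*} [TopologicalSpace X] [PolishSpace X] [LocallyCompactSpace X]
  [MeasurableSpace X] [BorelSpace X]

theorem Config.countable (γ : Config X) : γ.1.Countable := by
  let K := CompactExhaustion.choice X
  have hsub : γ.1 ⊆ ⋃ n : ℕ, γ.1 ∩ (Set.Icc (⟨1 / ((n : ℝ) + 2), by
      simp only [Set.mem_Ioi]; positivity⟩ : Weight) ⟨(n : ℝ) + 2, by
      simp only [Set.mem_Ioi]; positivity⟩ ×ˢ K n) := by
    intro y hy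
    obtain ⟨k, hk⟩ := K.exists_mem y.2
    have hpos : (0 : ℝ) < y.1 := y.1.2
    obtain ⟨l, hl⟩ := exists_nat_ge (max (y.1 : ℝ) (1 / (y.1 : ℝ)))
    have hl1 := (le_max_left _ _).trans hl
    have hl2 := (le_max_right _ _).trans hl
    have hml : (l : ℝ) ≤ (max k l : ℕ) := by exact_mod_cast le_max_right k l
    refine Set.mem_iUnion.2 ⟨max k l, hy, ⟨?_, ?_⟩, K.subset (le_max_left k l) hk⟩
    · change 1 / (((max k l : ℕ) : ℝ) + 2) ≤ (y.1 : ℝ)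
      rw [div_le_iff₀ hpos] at hl2
      rw [div_le_iff₀ (by positivity)]
      nlinarith
    · change (y.1 : ℝ) ≤ ((max k l : ℕ) : ℝ) + 2
      linarith
  refine Set.Countable.mono hsub (Set.countable_iUnion fun n => Set.Finite.countable ?_)
  refine γ.2 _ _ _ ?_ (K.isCompact n).isClosed.measurableSet ?_
  · change 1 / ((n : ℝ) + 2) < (n : ℝ) + 2
    rw [div_lt_iff₀ (by positivity)]
    have : (0 : ℝ) ≤ n := n.cast_nonneg
    nlinarith
  · rw [(K.isCompact n).isClosed.closure_eq]
    exact K.isCompact n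

theorem isDiscreteRadon_of_mem_pinpointing {γ : Config X} (hγ : γ ∈ pinpointing X) :
    IsDiscreteRadon (markedMeasure γ.1) := by
  refine ⟨⟨fun x => ?_⟩, γ.1, γ.countable, hγ.1, rfl⟩
  obtain ⟨K, hK, hx⟩ := exists_compact_mem_nhds x
  refine ⟨K, hx, ?_⟩
  rw [markedMeasure_apply _ hK.isClosed.measurableSet]
  exact hγ.2 K hK.isClosed.measurableSet (by rwa [hK.isClosed.closure_eq])

theorem Cone.tsum_atomSet_lt_top (η : Cone X) {Λ : Set X} (hΛ : MeasurableSet Λ)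
    (hc : IsCompact (closure Λ)) :
    ∑' y : atomSet η.1, Λ.indicator (fun _ => ENNReal.ofReal (y.1.1 : ℝ)) y.1.2 < ∞ := by
  have : IsLocallyFiniteMeasure η.1 := η.2.1
  rw [← markedMeasure_apply _ hΛ, η.markedMeasure_atomSet]
  exact (measure_mono subset_closure).trans_lt hc.measure_lt_top

/-- The configuration `{(s_x, x) : x ∈ τ(η)}`. -/
def Cone.toConfig (η : Cone X) : Config X :=
  ⟨atomSet η.1, fun a b Λ _ hΛ hc => by
    have h := ENNReal.finite_const_le_of_tsum_ne_top (η.tsum_atomSet_lt_top hΛ hc).ne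
      (ofReal_weight_ne_zero a)
    refine (h.image Subtype.val).subset ?_
    rintro y ⟨hy, hab, hyΛ⟩
    refine ⟨⟨y, hy⟩, ?_, rfl⟩
    simp only [Set.mem_ofPred_eq, Set.indicator_of_mem hyΛ]
    exact ENNReal.ofReal_le_ofReal hab.1⟩

/-- The bijection `ℛ : Π((0, ∞) × X) → 𝕂(X)`, which sends `γ` to `∑_{(s, x) ∈ γ} s δ_x`. -/
noncomputable def coneEquiv (X : Type*) [TopologicalSpace X] [PolishSpace X]
    [LocallyCompactSpace X] [MeasurableSpace X] [BorelSpace X] : pinpointing X ≃ Cone X where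
  toFun γ := ⟨markedMeasure γ.1.1, isDiscreteRadon_of_mem_pinpointing γ.2⟩
  invFun η := ⟨η.toConfig, injOn_atomSet η.1, fun _ hΛ hc => η.tsum_atomSet_lt_top hΛ hc⟩
  left_inv γ := Subtype.ext (Subtype.ext (atomSet_markedMeasure γ.2.1))
  right_inv η := Subtype.ext η.markedMeasure_atomSet

/-- For a measure `π` on `Γ((0, ∞) × X)`, its restriction to `Π((0, ∞) × X)` pushed forward
to `𝕂(X)` by `ℛ`. -/
noncomputable def coneMeasure (π : Measure (Config X)) : Measure (Cone X) :=
  (π.comap (Subtype.val : pinpointing X → Config X)).map (coneEquiv X)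

/-- The pairing `⟨ℛ⁻¹ η, φ⟩`. -/
noncomputable def pairing (η : Cone X) (φ : C_c(Marked X, ℝ)) : ℝ :=
  ∫ y, φ y ∂((coneEquiv X).symm η).1.toMeasure

/-- The class of test functions
`F(η) = g(⟨ℛ⁻¹ η, φ₁⟩, …, ⟨ℛ⁻¹ η, φ_N⟩)` with `g ∈ C_b(ℝ^N)` and `φ_i ∈ C_c((0, ∞) × X)`. -/
def IsCylinder (F : Cone X → ℝ) : Prop :=
  ∃ (N : ℕ) (g : (Fin N → ℝ) →ᵇ ℝ) (φ : Fin N → C_c(Marked X, ℝ)),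
    ∀ η : Cone X, F η = g fun i => pairing η (φ i)

/-- The measure `η - s_x δ_x`, where `s_x = η {x}`, i.e. `η` with its atom at `x` removed. -/
noncomputable def Cone.removeAtom (η : Cone X) (x : X) : Cone X :=
  ⟨η.1.restrict {x}ᶜ, by
    have : IsLocallyFiniteMeasure η.1 := η.2.1
    obtain ⟨C, hC, h0⟩ := η.2.exists_countable
    exact isDiscreteRadon_of_countable hC
      (le_antisymm ((Measure.restrict_apply_le _ _).trans h0.le) bot_le)⟩

theorem Cone.removeAtom_add (η : Cone X) (x : X) :
    (η.removeAtom x).1 + η.1 {x} • Measure.dirac x = η.1 := by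
  rw [← Measure.restrict_singleton]
  exact Measure.restrict_compl_add_restrict (measurableSet_singleton x)

/-- The measure `η + s δ_x`. -/
noncomputable def Cone.addAtom (η : Cone X) (s : Weight) (x : X) : Cone X :=
  ⟨η.1 + ENNReal.ofReal (s : ℝ) • Measure.dirac x, by
    have : IsLocallyFiniteMeasure η.1 := η.2.1
    obtain ⟨C, hC, h0⟩ := η.2.exists_countable
    have hCx : (insert x C).Countable := hC.insert x
    have : IsFiniteMeasure (ENNReal.ofReal (s : ℝ) • Measure.dirac x) :=
      ⟨by simp⟩
    have : IsLocallyFiniteMeasure (η.1 + ENNReal.ofReal (s : ℝ) • Measure.dirac x) :=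
      ⟨fun z => by
        obtain ⟨U, hU, hU'⟩ := η.1.finiteAt_nhds z
        refine ⟨U, hU, ?_⟩
        rw [Measure.add_apply]
        exact ENNReal.add_lt_top.2 ⟨hU', measure_lt_top _ _⟩⟩
    refine isDiscreteRadon_of_countable hCx ?_
    rw [Measure.add_apply, measure_mono_null (Set.compl_subset_compl.2 (Set.subset_insert x C)) h0,
      Measure.smul_apply, Measure.dirac_apply' _ hCx.measurableSet.compl]
    simp⟩

/-- The discrete death gradient `(D_x^- F)(η) = F(η - s_x δ_x) - F(η)`; it vanishes at points `x`
outside the support of `η`. -/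
noncomputable def deathGrad (F : Cone X → ℝ) (η : Cone X) (x : X) : ℝ :=
  F (η.removeAtom x) - F η

/-- The discrete birth gradient `(D_{(s,x)}^+ F)(η) = F(η + s δ_x) - F(η)`. -/
noncomputable def birthGrad (F : Cone X → ℝ) (η : Cone X) (y : Marked X) : ℝ :=
  F (η.addAtom y.1 y.2) - F η

/-- The directional derivative `(D_h^- F)(η) = ∫ (D_x^- F)(η) h(x) dη(x)`. -/
noncomputable def deathDeriv (h : C_c(X, ℝ)) (F : Cone X → ℝ) (η : Cone X) : ℝ :=
  ∫ x, deathGrad F η x * h x ∂η.1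

/-- The directional derivative
`(D_h^+ F)(η) = ∫_X ∫_{(0,∞)} (D_{(s,x)}^+ F)(η) s dν(s) h(x) dσ(x)`. -/
noncomputable def birthDeriv (ν : Measure Weight) (σ : Measure X) (h : C_c(X, ℝ))
    (F : Cone X → ℝ) (η : Cone X) : ℝ :=
  ∫ x, (∫ s, birthGrad F η (s, x) * (s : ℝ) ∂ν) * h x ∂σ

/-- `B_{ν,σ,h}(η) = ∫ h dη - ∫ s dν(s) ∫ h dσ`. -/
noncomputable def multTerm (ν : Measure Weight) (σ : Measure X) (h : C_c(X, ℝ))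
    (η : Cone X) : ℝ :=
  (∫ x, h x ∂η.1) - (∫ s, (s : ℝ) ∂ν) * ∫ x, h x ∂σ

end Space

end RadonCone

open RadonCone

namespace RadonCone

open Filter Topology
open scoped NNReal

set_option linter.unusedSectionVars false

/-! Under `ℛ` everything becomes a statement about the Poisson measure on `Γ(𝕏)`. Write `m = ν ⊗ σ`,
`w(s, x) = s h(x)`, `F = g(P)` and `G = g'(P')`, where `P = ∫ Φ dγ` and `P' = ∫ Φ' dγ` are
vector-valued. Removing an atom `y` of `γ` turns `P` into `P - Φ(y)`; adding a new one turns `P'`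
into `P' + Φ'(y)`. Hence `(D_h^- F) G = ∫ w(y) g(P - Φ y) g'(P') dγ - g(P) g'(P') ∫ w dγ`, `F (D_h^+
G) = ∫ w(y) g(P) g'(P' + Φ' y) dm - g(P) g'(P') ∫ w dm`, and `F G B` is the difference of the two
subtracted terms. The claim is therefore that the two leading terms have the same mean, which is the
Mecke identity (`IsPoisson.mecke`).

The Mecke identity rests on `(k + 1) p(k + 1) = r p(k)` for the Poisson weights `p`. It passes to
vectors of independent counts, then to integrands that are simple functions on a compact set
(`IsPoisson.mecke_simpleFunc`), then by dominated convergence to compactly supported `w`, and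
finally, with Campbell's bound, to `m`-integrable continuous `w`. The last step is essential: `s
h(x)` has no compact support in `𝕏`.

Two facts make the transfer legitimate. The Poisson measure is carried by `Π(𝕏)`: non-atomicity of
`σ` excludes two points over one position, and the first moment of `ν` gives finite local mass
(`IsPoisson.ae_mem_pinpointing`). Moreover `ℛ` is an isomorphism for the Borel structures of the
vague topologies (`coneMeasurableEquiv`). -/

instance instPolishSpaceWeight : PolishSpace Weight := (isOpen_Ioi (a := (0 : ℝ))).polishSpace

instance instLocallyCompactSpaceWeight : LocallyCompactSpace Weight :=
  (isOpen_Ioi (a := (0 : ℝ))).locallyCompactSpace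

/-! ### Countable description of the vague topology and its Borel structure -/

section Vague

variable {Y : Type*} [TopologicalSpace Y] [T2Space Y] [LocallyCompactSpace Y]
  [SecondCountableTopology Y]

theorem exists_cutoff_of_isCompact {K : Set Y} (hK : IsCompact K) :
    ∃ χ : C_c(Y, ℝ), (∀ y, χ y ∈ Icc (0 : ℝ) 1) ∧ ∀ y ∈ K, χ y = 1 := by
  obtain ⟨f, h1, -, hc, hI⟩ := exists_continuous_one_zero_of_isCompact hK isClosed_empty
    (disjoint_empty K)
  exact ⟨⟨f, hc⟩, hI, fun y hy => h1 hy⟩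

theorem exists_cutoff (Y : Type*) [TopologicalSpace Y] [T2Space Y] [LocallyCompactSpace Y]
    [SecondCountableTopology Y] :
    ∃ χ : ℕ → C_c(Y, ℝ), (∀ n y, χ n y ∈ Icc (0 : ℝ) 1) ∧
      ∀ K : Set Y, IsCompact K → ∃ n, ∀ k ≥ n, ∀ y ∈ K, χ k y = 1 := by
  let K := CompactExhaustion.choice Y
  choose χ h01 h1 using fun n => exists_cutoff_of_isCompact (K.isCompact n)
  refine ⟨χ, h01, fun L hL => ?_⟩
  obtain ⟨n, hn⟩ := K.exists_superset_of_isCompact hL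
  exact ⟨n, fun k hk y hy => h1 k y (K.subset hk (hn hy))⟩

theorem tendsto_cutoff {χ : ℕ → C_c(Y, ℝ)}
    (hχ : ∀ K : Set Y, IsCompact K → ∃ n, ∀ k ≥ n, ∀ y ∈ K, χ k y = 1) (y : Y) :
    Tendsto (fun n => χ n y) atTop (𝓝 1) := by
  obtain ⟨n, hn⟩ := hχ {y} isCompact_singleton
  exact tendsto_const_nhds.congr' (eventually_atTop.2 ⟨n, fun k hk => (hn k hk y rfl).symm⟩)

/-- The functions vanishing off a fixed compact set form a separable space in the compact-open
topology. The error is measured against a cutoff `χ` that itself lies in `D`, since a measure of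
infinite mass gives no control over a constant error. -/
theorem exists_countable_uniformly_dense (Y : Type*) [TopologicalSpace Y] [T2Space Y]
    [LocallyCompactSpace Y] [SecondCountableTopology Y] :
    ∃ D : Set C_c(Y, ℝ), D.Countable ∧ ∀ f : C_c(Y, ℝ), ∃ χ ∈ D, (∀ y, 0 ≤ χ y) ∧
      ∀ ε > 0, ∃ g ∈ D, ∀ y, |f y - g y| ≤ ε * χ y := by
  let K := CompactExhaustion.choice Y
  choose χ h01 h1 using fun n => exists_cutoff_of_isCompact (K.isCompact n)
  let E : ℕ → Set C(Y, ℝ) := fun n => {f | ∀ y ∉ K n, f y = 0}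
  have hE : ∀ n, ∃ s : Set (E n), s.Countable ∧ Dense s :=
    fun n => TopologicalSpace.exists_countable_dense (E n)
  choose s hsc hsd using hE
  let T : ∀ n, E n → C_c(Y, ℝ) := fun n f => ⟨f.1, HasCompactSupport.intro (K.isCompact n) f.2⟩
  refine ⟨range χ ∪ ⋃ n, T n '' s n,
    (countable_range χ).union (countable_iUnion fun n => (hsc n).image _), fun f => ?_⟩
  obtain ⟨n, hn⟩ := K.exists_superset_of_isCompact f.hasCompactSupport.isCompact
  refine ⟨χ n, Or.inl ⟨n, rfl⟩, fun y => (h01 n y).1, fun ε hε => ?_⟩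
  have hf : f.toContinuousMap ∈ E n := fun y hy => image_eq_zero_of_notMem_tsupport
    (f := f) fun h => hy (hn h)
  let U : Set (E n) := {g | MapsTo (g.1 - f.toContinuousMap) (K n) (Metric.ball 0 ε)}
  have hU : IsOpen U := (ContinuousMap.isOpen_setOfPred_mapsTo (K.isCompact n)
    Metric.isOpen_ball).preimage (continuous_subtype_val.sub continuous_const)
  obtain ⟨g, hgs, hgU⟩ := (hsd n).exists_mem_open hU ⟨⟨_, hf⟩, fun y _ => by simpa using hε⟩
  refine ⟨T n g, Or.inr (mem_iUnion.2 ⟨n, g, hgs, rfl⟩), fun y => ?_⟩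
  by_cases hy : y ∈ K n
  · have h2 := hgU hy
    rw [h1 n y hy, mul_one, abs_sub_comm]
    rw [mem_ball_zero_iff, Real.norm_eq_abs] at h2
    exact h2.le
  · have h3 : f y = 0 := hf y hy
    have h4 : T n g y = 0 := g.2 y hy
    rw [h3, h4]
    simpa using mul_nonneg hε.le (h01 n y).1

variable [MeasurableSpace Y] [BorelSpace Y] {α : Type*}

theorem integrable_compactlySupported {E : Type*} [NormedAddCommGroup E] (f : C_c(Y, E)) (μ : Measure Y)
    [IsFiniteMeasureOnCompacts μ] : Integrable f μ :=
  f.continuous.integrable_of_hasCompactSupport f.hasCompactSupport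

/-- Near a given point, `∫ χ` is bounded, because it is one of the countably many continuous
functions. So `∫ f` is a locally uniform limit of functions `∫ g` with `g ∈ D`, and is continuous
for the coarser topology. -/
theorem exists_countable_vagueTopology_eq (m : α → Measure Y)
    [∀ a, IsFiniteMeasureOnCompacts (m a)] : ∃ D : Set C_c(Y, ℝ), D.Countable ∧
      vagueTopology m =
        TopologicalSpace.induced (fun a (f : D) => ∫ y, f.1 y ∂(m a)) inferInstance := by
  obtain ⟨D, hD, hdense⟩ := exists_countable_uniformly_dense Y
  refine ⟨D, hD, le_antisymm ?_ ?_⟩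
  · rw [← continuous_iff_le_induced]
    refine @continuous_pi _ _ _ (vagueTopology m) _ _ fun f => ?_
    exact continuous_iff_le_induced.2 (iInf_le _ f.1)
  · let t : TopologicalSpace α :=
      TopologicalSpace.induced (fun a (f : D) => ∫ y, f.1 y ∂(m a)) inferInstance
    have hcont : ∀ f ∈ D, Continuous fun a => ∫ y, f y ∂(m a) := fun f hf =>
      (continuous_apply (A := fun _ : D => ℝ) ⟨f, hf⟩).comp
        (continuous_induced_dom (f := fun a (f : D) => ∫ y, f.1 y ∂(m a)))
    refine le_iInf fun f => continuous_iff_le_induced.1 ?_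
    obtain ⟨χ, hχD, hχ0, hf⟩ := hdense f
    rw [continuous_iff_continuousAt]
    intro a
    rw [Metric.continuousAt_iff']
    intro ε hε
    -- A strict upper bound for `∫ χ` at `a`, and hence in a neighbourhood of `a`.
    set c : ℝ := ∫ y, χ y ∂(m a) + 1
    have hc0 : 0 < c := add_pos_of_nonneg_of_pos (integral_nonneg hχ0) one_pos
    have hδ : 0 < ε / (4 * c) := by positivity
    obtain ⟨g, hgD, hg⟩ := hf _ hδ
    have hest : ∀ b, |∫ y, f y ∂(m b) - ∫ y, g y ∂(m b)| ≤
        ε / (4 * c) * ∫ y, χ y ∂(m b) := by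
      intro b
      rw [← integral_sub (integrable_compactlySupported f _) (integrable_compactlySupported g _),
        ← integral_const_mul, ← Real.norm_eq_abs]
      exact norm_integral_le_of_norm_le ((integrable_compactlySupported χ _).const_mul _)
        (ae_of_all _ hg)
    have h1 : ∀ᶠ b in 𝓝 a, ∫ y, χ y ∂(m b) < c :=
      (hcont χ hχD).continuousAt.eventually_lt continuousAt_const (lt_add_one _)
    have h2 := Metric.continuousAt_iff'.1 ((hcont g hgD).continuousAt (x := a)) (ε / 4) (by positivity)
    filter_upwards [h1, h2] with b hb1 hb2
    have key : ∀ b, ∫ y, χ y ∂(m b) < c →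
        |∫ y, f y ∂(m b) - ∫ y, g y ∂(m b)| ≤ ε / 4 := by
      intro b hb
      refine (hest b).trans ((mul_le_mul_of_nonneg_left hb.le hδ.le).trans (le_of_eq ?_))
      field_simp
    have k1 := key b hb1
    have k2 := key a (lt_add_one _)
    rw [Real.dist_eq] at hb2 ⊢
    rw [abs_le] at k1 k2
    rw [abs_lt] at hb2 ⊢
    constructor <;> linarith [k1.1, k1.2, k2.1, k2.2, hb2.1, hb2.2]

/-- Countability of `D` is what matters here: only then is the Borel `σ`-algebra of `D → ℝ` known to
be the product one, so that measurability can be tested on single integrals. -/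
theorem measurable_borel_vagueTopology {β : Type*} [MeasurableSpace β] (m : α → Measure Y)
    [∀ a, IsFiniteMeasureOnCompacts (m a)] {T : β → α}
    (hT : ∀ f : C_c(Y, ℝ), Measurable fun b => ∫ y, f y ∂(m (T b))) :
    @Measurable _ _ _ (@borel α (vagueTopology m)) T := by
  obtain ⟨D, hD, h⟩ := exists_countable_vagueTopology_eq m
  have : Countable D := hD.to_subtype
  rw [h, borel_comap, ← BorelSpace.measurable_eq (α := D → ℝ), measurable_comap_iff]
  exact measurable_pi_lambda _ fun f => hT f.1

theorem measurable_integral_borel_vagueTopology (m : α → Measure Y) (f : C_c(Y, ℝ)) :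
    @Measurable _ _ (@borel α (vagueTopology m)) _ fun a => ∫ y, f y ∂(m a) := by
  let : TopologicalSpace α := vagueTopology m
  let : MeasurableSpace α := borel α
  have : BorelSpace α := ⟨rfl⟩
  have : Continuous fun a => ∫ y, f y ∂(m a) := continuous_iff_le_induced.2 (iInf_le _ f)
  exact this.measurable

end Vague

/-! ### Configurations as counting measures -/

section ConfigMeasure

variable {X : Type*} [TopologicalSpace X] [PolishSpace X] [LocallyCompactSpace X]
  [MeasurableSpace X] [BorelSpace X]

theorem Config.finite_inter (γ : Config X) {S : Set (Marked X)} (hS : IsCompact S) :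
    (γ.1 ∩ S).Finite := by
  have h1 := hS.image continuous_fst
  have h2 := hS.image continuous_snd
  have : Nonempty Weight := ⟨⟨1, mem_Ioi.2 one_pos⟩⟩
  obtain ⟨a, ha⟩ := h1.bddBelow
  obtain ⟨b, hb⟩ := h1.bddAbove
  -- `Config` asks for a strict inequality of endpoints, which `a` and `b` may violate when `S` is
  -- empty or carries a single weight.
  have hpos : (0 : ℝ) < max (a : ℝ) b + 1 := by
    have : (0 : ℝ) < a := a.2
    have := le_max_left (a : ℝ) b
    linarith
  refine (γ.2 a ⟨max (a : ℝ) b + 1, hpos⟩ (Prod.snd '' S) ?_ h2.isClosed.measurableSet ?_).subset ?_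
  · change (a : ℝ) < max (a : ℝ) b + 1
    linarith [le_max_left (a : ℝ) b]
  · rwa [h2.isClosed.closure_eq]
  · rintro y ⟨hy, hyS⟩
    refine ⟨hy, ⟨ha ⟨y, hyS, rfl⟩, ?_⟩, ⟨y, hyS, rfl⟩⟩
    change (y.1 : ℝ) ≤ max (a : ℝ) b + 1
    have h3 : (y.1 : ℝ) ≤ b := hb ⟨y, hyS, rfl⟩
    linarith [le_max_right (a : ℝ) b]

theorem Config.toMeasure_apply (γ : Config X) {A : Set (Marked X)} (hA : MeasurableSet A) :
    γ.toMeasure A = ((γ.1 ∩ A).encard : ℝ≥0∞) := by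
  rw [Config.toMeasure, Measure.sum_apply _ hA, ← ENNReal.tsum_set_one]
  simp_rw [Measure.dirac_apply' _ hA]
  rw [tsum_subtype γ.1 (A.indicator 1), tsum_subtype (γ.1 ∩ A) (fun _ => (1 : ℝ≥0∞)),
    Set.indicator_indicator]
  rfl

theorem Config.toMeasure_apply_eq_count (γ : Config X) {A : Set (Marked X)}
    (hA : MeasurableSet A) (hc : IsCompact (closure A)) :
    γ.toMeasure A = (Config.count A γ : ℝ≥0∞) := by
  have hfin : (γ.1 ∩ A).Finite :=
    (γ.finite_inter hc).subset (inter_subset_inter_right _ subset_closure)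
  rw [γ.toMeasure_apply hA, ← hfin.cast_ncard_eq]
  rfl

instance Config.instIsFiniteMeasureOnCompacts (γ : Config X) :
    IsFiniteMeasureOnCompacts γ.toMeasure :=
  ⟨fun K hK => by
    rw [γ.toMeasure_apply_eq_count hK.isClosed.measurableSet (by rwa [hK.isClosed.closure_eq])]
    exact ENNReal.natCast_lt_top _⟩

theorem Config.integral_toMeasure (γ : Config X) (f : Marked X → ℝ) :
    ∫ y, f y ∂γ.toMeasure = ∑' y : γ.1, f y := by
  have : Countable γ.1 := γ.countable.to_subtype
  have h := integral_sum_dirac (f := f) (x := fun y : γ.1 => y.1) (c := fun _ => 1) (by simp)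
  simpa [Config.toMeasure] using h

theorem Config.integrable_toMeasure_iff (γ : Config X) (f : Marked X → ℝ) :
    Integrable f γ.toMeasure ↔ Summable fun y : γ.1 => ‖f y‖ := by
  have : Countable γ.1 := γ.countable.to_subtype
  have h := integrable_sum_dirac_iff (f := f) (x := fun y : γ.1 => y.1) (c := fun _ => 1) (by simp)
  simpa [Config.toMeasure] using h

theorem Config.integral_markedMeasure (γ : Config X) (f : X → ℝ) :
    ∫ x, f x ∂(markedMeasure γ.1) = ∫ y, (y.1 : ℝ) * f y.2 ∂γ.toMeasure := by
  have : Countable γ.1 := γ.countable.to_subtype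
  rw [γ.integral_toMeasure, markedMeasure, integral_sum_dirac (by simp)]
  refine tsum_congr fun y => ?_
  rw [ENNReal.toReal_ofReal (le_of_lt y.1.1.2), smul_eq_mul]

theorem Config.integrable_markedMeasure_iff (γ : Config X) (f : X → ℝ) :
    Integrable f (markedMeasure γ.1) ↔
      Integrable (fun y : Marked X => (y.1 : ℝ) * f y.2) γ.toMeasure := by
  have : Countable γ.1 := γ.countable.to_subtype
  rw [γ.integrable_toMeasure_iff, markedMeasure, integrable_sum_dirac_iff (by simp)]
  refine summable_congr fun y => ?_
  rw [ENNReal.toReal_ofReal (le_of_lt y.1.1.2), norm_mul, Real.norm_of_nonneg (le_of_lt y.1.1.2)]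

theorem Config.measurable_integral (φ : C_c(Marked X, ℝ)) :
    Measurable fun γ : Config X => ∫ y, φ y ∂γ.toMeasure :=
  measurable_integral_borel_vagueTopology (fun γ : Config X => γ.toMeasure) φ

end ConfigMeasure

/-! ### Measurability of `ℛ` and of its inverse -/

section ConeMeasurable

variable {X : Type*} [TopologicalSpace X] [PolishSpace X] [LocallyCompactSpace X]
  [MeasurableSpace X] [BorelSpace X]

instance Cone.instIsLocallyFiniteMeasure (η : Cone X) : IsLocallyFiniteMeasure η.1 := η.2.1

theorem Cone.measurable_integral (f : C_c(X, ℝ)) : Measurable fun η : Cone X => ∫ x, f x ∂η.1 :=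
  measurable_integral_borel_vagueTopology (fun η : Cone X => η.1) f

theorem Cone.measurable_lintegral (f : C_c(X, ℝ)) (hf : ∀ x, 0 ≤ f x) :
    Measurable fun η : Cone X => ∫⁻ x, ENNReal.ofReal (f x) ∂η.1 := by
  simp_rw [← ofReal_integral_eq_lintegral_ofReal (integrable_compactlySupported f _)
    (ae_of_all _ hf)]
  exact (Cone.measurable_integral f).ennreal_ofReal

/-- The weight `χ` makes the measures finite, so closed sets suffice as a π-system. The indicator of
a closed set is a limit of bounded continuous functions, and their products with `χ` are admissible
test functions. -/
theorem Cone.measurable_withDensity (χ : C_c(X, ℝ)) (hχ : ∀ x, 0 ≤ χ x) :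
    Measurable fun η : Cone X => η.1.withDensity fun x => ENNReal.ofReal (χ x) := by
  have hm : Measurable fun x => ENNReal.ofReal (χ x) := χ.continuous.measurable.ennreal_ofReal
  have hfin : ∀ η : Cone X, IsFiniteMeasure (η.1.withDensity fun x => ENNReal.ofReal (χ x)) :=
    fun η => isFiniteMeasure_withDensity_ofReal
      (integrable_compactlySupported χ η.1).hasFiniteIntegral
  refine Measurable.measure_of_isPiSystem
    ((BorelSpace.measurable_eq (α := X)).trans borel_eq_generateFrom_isClosed)
    isPiSystem_isClosed (fun F hF => ?_) ?_
  · refine ENNReal.measurable_of_tendsto (f := fun n (η : Cone X) => ∫⁻ x, (hF.apprSeq n x : ℝ≥0∞)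
      ∂(η.1.withDensity fun x => ENNReal.ofReal (χ x))) (fun n => ?_)
      (tendsto_pi_nhds.2 fun η => HasOuterApproxClosed.tendsto_lintegral_apprSeq hF _)
    let g : C_c(X, ℝ) := ⟨⟨fun x => χ x * (hF.apprSeq n x : ℝ), by fun_prop⟩,
      χ.hasCompactSupport.mul_right⟩
    have hg := Cone.measurable_lintegral g fun x => mul_nonneg (hχ x) (NNReal.coe_nonneg _)
    convert hg using 2 with η
    have hn : Measurable fun x => (hF.apprSeq n x : ℝ≥0∞) :=
      (hF.apprSeq n).continuous.measurable.coe_nnreal_ennreal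
    rw [lintegral_withDensity_eq_lintegral_mul _ hm hn]
    refine lintegral_congr fun x => ?_
    change _ = ENNReal.ofReal (χ x * (hF.apprSeq n x : ℝ))
    rw [ENNReal.ofReal_mul (hχ x), ENNReal.ofReal_coe_nnreal]
    rfl
  · simp_rw [withDensity_apply _ MeasurableSet.univ, Measure.restrict_univ]
    exact Cone.measurable_lintegral χ hχ

theorem Cone.measurable_restrict {L : Set X} (hL : IsCompact L) :
    Measurable fun η : Cone X => η.1.restrict L := by
  obtain ⟨χ, h01, h1⟩ := exists_cutoff_of_isCompact hL
  refine Measure.measurable_of_measurable_coe _ fun B hB => ?_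
  have hLm := hL.isClosed.measurableSet
  have h := (Measure.measurable_coe (hB.inter hLm)).comp
    (Cone.measurable_withDensity χ fun x => (h01 x).1)
  convert h using 2 with η
  simp only [Function.comp_apply]
  rw [Measure.restrict_apply hB, withDensity_apply _ (hB.inter hLm),
    setLIntegral_congr_fun (g := fun _ => 1) (hB.inter hLm) fun x hx => by simp [h1 x hx.2]]
  simp

theorem Cone.measurable_apply_of_isCompact {L : Set X} (hL : IsCompact L) :
    Measurable fun η : Cone X => η.1 L := by
  have h := (Measure.measurable_coe MeasurableSet.univ).comp (Cone.measurable_restrict hL)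
  convert h using 2 with η
  simp

/-- The restriction of `η` to a compact set, normalized to have mass at most one. -/
noncomputable def Cone.normalizedKernel {L : Set X} (hL : IsCompact L) : Kernel (Cone X) X where
  toFun η := (1 + η.1 L)⁻¹ • η.1.restrict L
  measurable' := by
    refine Measure.measurable_of_measurable_coe _ fun B hB => ?_
    simp only [Measure.smul_apply, smul_eq_mul]
    exact ((measurable_const.add (Cone.measurable_apply_of_isCompact hL)).inv).mul
      ((Measure.measurable_coe hB).comp (Cone.measurable_restrict hL))

theorem Cone.normalizedKernel_apply {L : Set X} (hL : IsCompact L) (η : Cone X) :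
    Cone.normalizedKernel hL η = (1 + η.1 L)⁻¹ • η.1.restrict L := rfl

/-- This uniform bound is the reason for the normalization: `η L` is finite for each `η` but
unbounded in `η`, while the measurability results for parametrized integrals need a finite kernel.
-/
instance Cone.instIsFiniteKernel {L : Set X} (hL : IsCompact L) :
    IsFiniteKernel (Cone.normalizedKernel hL) :=
  ⟨1, ENNReal.one_lt_top, fun η => by
    rw [Cone.normalizedKernel_apply, Measure.smul_apply, smul_eq_mul,
      Measure.restrict_apply_univ, mul_comm, ← div_eq_mul_inv]
    exact ENNReal.div_le_of_le_mul (by rw [one_mul]; exact le_add_self)⟩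

/-- Extension of a real number to a weight. -/
noncomputable def toWeight (r : ℝ) : Weight :=
  ⟨if 0 < r then r else 1, by
    split_ifs with h
    exacts [h, mem_Ioi.2 one_pos]⟩

theorem toWeight_coe (s : Weight) : toWeight (s : ℝ) = s := by
  have h : (0 : ℝ) < s := s.2
  exact Subtype.ext (if_pos h)

theorem measurable_toWeight : Measurable toWeight :=
  (Measurable.ite measurableSet_Ioi measurable_id measurable_const).subtype_mk

/-- With `s_x = η {x}`, the pairing `∑ φ(s_x, x)` over the atoms equals `∫ φ(s_x, x) / s_x dη(x)`.
This is an integral against a kernel of a function jointly measurable in `(η, x)`. -/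
theorem Cone.measurable_pairing (φ : C_c(Marked X, ℝ)) :
    Measurable fun η : Cone X => pairing η φ := by
  set L : Set X := Prod.snd '' tsupport φ
  have hL : IsCompact L := φ.hasCompactSupport.isCompact.image continuous_snd
  have hLm : MeasurableSet L := hL.isClosed.measurableSet
  have hLη := Cone.measurable_apply_of_isCompact hL
  let κ := Cone.normalizedKernel hL
  -- The factor `1 + η L` undoes the normalization, so `r η x` is the weight `s_x` at every atom in
  -- `L`.
  let r : Cone X → X → ℝ := fun η x => ((1 + η.1 L) * κ η {x}).toReal
  have hr : Measurable fun p : Cone X × X => r p.1 p.2 := by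
    refine (Measurable.mul ((measurable_const.add hLη).comp measurable_fst) ?_).ennreal_toReal
    -- The mass of `{x}` is the mass of a section of the diagonal, which gives joint measurability
    -- in `(η, x)`.
    have ht : MeasurableSet {q : (Cone X × X) × X | q.1.2 = q.2} :=
      measurableSet_eq_fun (measurable_snd.comp measurable_fst) measurable_snd
    have h := Kernel.measurable_kernel_prodMk_left (κ := κ.comap Prod.fst measurable_fst) ht
    convert h using 2 with p
    rw [Kernel.comap_apply]
    congr 1
    ext x
    exact eq_comm
  let f : Cone X → X → ℝ := fun η x => φ (toWeight (r η x), x) / r η x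
  have hf : StronglyMeasurable (Function.uncurry f) := by
    have : Measurable (Function.uncurry f) :=
      (φ.continuous.measurable.comp ((measurable_toWeight.comp hr).prodMk measurable_snd)).div hr
    exact this.stronglyMeasurable
  have hint := (hf.integral_kernel_prod_right (κ := κ)).measurable
  have key : ∀ η : Cone X, pairing η φ = (1 + η.1 L).toReal * ∫ x, f η x ∂(κ η) := by
    intro η
    have hfin : η.1 L < ∞ := hL.measure_lt_top
    have hne : (1 + η.1 L) ≠ 0 := by simp
    have hne' : (1 + η.1 L) ≠ ∞ := by simp [hfin.ne]
    have hr' : ∀ y : Marked X, y ∈ atomSet η.1 → y.2 ∈ L → r η y.2 = y.1 := by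
      intro y hy hyL
      change ((1 + η.1 L) * κ η {y.2}).toReal = y.1
      rw [show κ η = _ from Cone.normalizedKernel_apply hL η, Measure.smul_apply, smul_eq_mul,
        ← mul_assoc, ENNReal.mul_inv_cancel hne hne', one_mul, Measure.restrict_apply (by simp),
        Set.inter_eq_left.2 (by simpa using hyL), show η.1 {y.2} = _ from hy,
        ENNReal.toReal_ofReal (le_of_lt y.1.2)]
    rw [show κ η = _ from Cone.normalizedKernel_apply hL η, integral_smul_measure,
      ENNReal.toReal_inv, smul_eq_mul, ← mul_assoc,
      mul_inv_cancel₀ (ENNReal.toReal_ne_zero.2 ⟨hne, hne'⟩), one_mul,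
      ← integral_indicator hLm]
    change ∫ y, φ y ∂η.toConfig.toMeasure = _
    conv_rhs => rw [← η.markedMeasure_atomSet]
    rw [η.toConfig.integral_toMeasure]
    change _ = ∫ x, _ ∂(markedMeasure η.toConfig.1)
    rw [η.toConfig.integral_markedMeasure, η.toConfig.integral_toMeasure]
    refine tsum_congr fun y => ?_
    by_cases hyL : y.1.2 ∈ L
    · rw [Set.indicator_of_mem hyL]
      change _ = _ * (φ (toWeight (r η y.1.2), y.1.2) / r η y.1.2)
      rw [hr' y.1 y.2 hyL, toWeight_coe, mul_div_cancel₀]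
      exact ne_of_gt y.1.1.2
    · rw [Set.indicator_of_notMem hyL, mul_zero]
      exact image_eq_zero_of_notMem_tsupport fun h => hyL ⟨y.1, h, rfl⟩
  simp_rw [key]
  exact (measurable_const.add hLη).ennreal_toReal.mul hint

theorem integrable_mul_of_mem_pinpointing {γ : Config X} (hγ : γ ∈ pinpointing X)
    (f : C_c(X, ℝ)) : Integrable (fun y : Marked X => (y.1 : ℝ) * f y.2) γ.toMeasure := by
  have := (isDiscreteRadon_of_mem_pinpointing hγ).1
  exact (γ.integrable_markedMeasure_iff f).1 (integrable_compactlySupported f _)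

/-- The product of a continuous function with a compactly supported one. -/
def cutoffMul {Y : Type*} [TopologicalSpace Y] (χ : C_c(Y, ℝ)) (w : C(Y, ℝ)) : C_c(Y, ℝ) :=
  ⟨⟨fun y => χ y * w y, by fun_prop⟩, χ.hasCompactSupport.mul_right⟩

/-- The function `(s, x) ↦ s f(x)`. -/
def weightMul (f : C_c(X, ℝ)) : C(Marked X, ℝ) :=
  ⟨fun y => (y.1 : ℝ) * f y.2, by fun_prop⟩

/-- The function `s f(x)` is not compactly supported in `𝕏`, since `s` ranges over all of `(0, ∞)`.
It is truncated by cutoffs; finite local mass on `Π(𝕏)` provides the dominating function. -/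
theorem measurable_coneEquiv : Measurable (coneEquiv X) := by
  obtain ⟨χ, h01, h1⟩ := exists_cutoff (Marked X)
  refine measurable_borel_vagueTopology (fun η : Cone X => η.1) fun f => ?_
  refine measurable_of_tendsto_metrizable (f := fun n (γ : pinpointing X) =>
    ∫ y, cutoffMul (χ n) (weightMul f) y ∂γ.1.toMeasure)
    (fun n => (Config.measurable_integral _).comp measurable_subtype_coe)
    (tendsto_pi_nhds.2 fun γ => ?_)
  change Tendsto _ _ (𝓝 (∫ x, f x ∂(markedMeasure γ.1.1)))
  rw [γ.1.integral_markedMeasure]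
  refine tendsto_integral_of_dominated_convergence (fun y => ‖(y.1 : ℝ) * f y.2‖)
    (fun n => (cutoffMul (χ n) (weightMul f)).continuous.measurable.aestronglyMeasurable)
    (integrable_mul_of_mem_pinpointing γ.2 f).norm (fun n => ae_of_all _ fun y => ?_)
    (ae_of_all _ fun y => ?_)
  · change ‖χ n y * ((y.1 : ℝ) * f y.2)‖ ≤ _
    rw [norm_mul]
    refine mul_le_of_le_one_left (norm_nonneg _) ?_
    rw [Real.norm_of_nonneg (h01 n y).1]
    exact (h01 n y).2
  · have h := (tendsto_cutoff h1 y).mul_const ((y.1 : ℝ) * f y.2)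
    rwa [one_mul] at h

theorem measurable_coneEquiv_symm : Measurable (coneEquiv X).symm := by
  have : Measurable fun η : Cone X => ((coneEquiv X).symm η).1 :=
    measurable_borel_vagueTopology (fun γ : Config X => γ.toMeasure) fun φ =>
      Cone.measurable_pairing φ
  exact this.subtype_mk

/-- `ℛ` as an isomorphism of measurable spaces. -/
noncomputable def coneMeasurableEquiv (X : Type*) [TopologicalSpace X] [PolishSpace X]
    [LocallyCompactSpace X] [MeasurableSpace X] [BorelSpace X] : pinpointing X ≃ᵐ Cone X where
  toEquiv := coneEquiv X
  measurable_toFun := measurable_coneEquiv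
  measurable_invFun := measurable_coneEquiv_symm

end ConeMeasurable

/-! ### The shift identity for products of Poisson laws -/

section PoissonLaw

/-- The cancellation `(k + 1) / (k + 1)! = 1 / k!` is the only property of the Poisson law behind
the Mecke identity. -/
theorem succ_mul_poissonMeasure_singleton (r : ℝ≥0) (k : ℕ) :
    ((k + 1 : ℕ) : ℝ≥0∞) * poissonMeasure r {k + 1} = r * poissonMeasure r {k} := by
  rw [poissonMeasure_singleton, poissonMeasure_singleton, ← ENNReal.ofReal_natCast,
    ← ENNReal.ofReal_mul (by positivity), ← ENNReal.ofReal_coe_nnreal,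
    ← ENNReal.ofReal_mul (by positivity)]
  congr 1
  rw [Nat.factorial_succ, pow_succ]
  push_cast
  field_simp

variable {ι : Type*} [Fintype ι] [DecidableEq ι]

/-- Both sides are compared on singletons. If `ω i = 0`, both vanish; otherwise `ω = ω' + e_i`, the
factor at `i` obeys the one-dimensional relation and the other factors agree. As an equality of
measures it yields integral formulas without integrability assumptions. -/
theorem withDensity_pi_poissonMeasure (r : ι → ℝ≥0) (i : ι) :
    (Measure.pi fun j => poissonMeasure (r j)).withDensity (fun ω => (ω i : ℝ≥0∞)) =
      (r i : ℝ≥0∞) • (Measure.pi fun j => poissonMeasure (r j)).map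
        (fun ω => ω + Pi.single i 1) := by
  refine Measure.ext_of_singleton fun ω => ?_
  rw [withDensity_apply _ (measurableSet_singleton ω), lintegral_singleton,
    Measure.smul_apply, smul_eq_mul,
    Measure.map_apply (measurable_id'.add_const _) (measurableSet_singleton ω)]
  rcases Nat.eq_zero_or_eq_succ_pred (ω i) with h | h
  · have : (fun ω' : ι → ℕ => ω' + Pi.single i 1) ⁻¹' {ω} = ∅ := by
      ext ω'
      simp only [mem_preimage, mem_singleton_iff, mem_empty_iff_false, iff_false]
      intro h'
      have := congrFun h' i
      simp [h] at this
    rw [this, h]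
    simp
  · set k := (ω i).pred
    obtain ⟨ω', hω'⟩ : ∃ ω' : ι → ℕ, ω' + Pi.single i 1 = ω := by
      refine ⟨Function.update ω i k, ?_⟩
      ext j
      by_cases hj : j = i
      · subst hj
        simp [h]
      · simp [hj]
    have hpre : (fun ω' : ι → ℕ => ω' + Pi.single i 1) ⁻¹' {ω} = {ω'} := by
      ext ω''
      simp only [mem_preimage, mem_singleton_iff]
      rw [← hω']
      exact add_left_inj _
    have hi : ω i = ω' i + 1 := by rw [← hω']; simp
    have hj : ∀ j ∈ Finset.univ.erase i, poissonMeasure (r j) {ω j} =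
        poissonMeasure (r j) {ω' j} := by
      intro j hj
      rw [← hω']
      simp [Finset.ne_of_mem_erase hj]
    rw [hpre, Measure.pi_singleton, Measure.pi_singleton,
      ← Finset.mul_prod_erase _ _ (Finset.mem_univ i),
      ← Finset.mul_prod_erase _ _ (Finset.mem_univ i), Finset.prod_congr rfl hj, ← mul_assoc,
      ← mul_assoc, hi, succ_mul_poissonMeasure_singleton]

theorem lintegral_mul_pi_poissonMeasure (r : ι → ℝ≥0) (i : ι) (H : (ι → ℕ) → ℝ≥0∞) :
    ∫⁻ ω, (ω i : ℝ≥0∞) * H ω ∂(Measure.pi fun j => poissonMeasure (r j)) =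
      r i * ∫⁻ ω, H (ω + Pi.single i 1) ∂(Measure.pi fun j => poissonMeasure (r j)) := by
  have hm : Measurable H := measurable_of_countable H
  rw [← lintegral_map hm (measurable_id'.add_const _), ← smul_eq_mul (r i : ℝ≥0∞),
    ← lintegral_smul_measure]
  rw [← withDensity_pi_poissonMeasure,
    lintegral_withDensity_eq_lintegral_mul _ (measurable_of_countable _) hm]
  rfl

theorem integral_mul_pi_poissonMeasure (r : ι → ℝ≥0) (i : ι) (H : (ι → ℕ) → ℝ) :
    ∫ ω, (ω i : ℝ) * H ω ∂(Measure.pi fun j => poissonMeasure (r j)) =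
      r i * ∫ ω, H (ω + Pi.single i 1) ∂(Measure.pi fun j => poissonMeasure (r j)) := by
  have hm : Measurable H := measurable_of_countable H
  have h1 := integral_withDensity_eq_integral_toReal_smul
    (μ := Measure.pi fun j => poissonMeasure (r j)) (f := fun ω => (ω i : ℝ≥0∞))
    (measurable_of_countable _) (ae_of_all _ fun ω => ENNReal.natCast_lt_top _) H
  rw [withDensity_pi_poissonMeasure, integral_smul_measure, integral_map
    (measurable_id'.add_const _).aemeasurable hm.aestronglyMeasurable] at h1
  simpa using h1.symm

end PoissonLaw

/-! ### Joint laws and factorial moments of counts -/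

section Counts

variable {X : Type*} [TopologicalSpace X] [PolishSpace X] [LocallyCompactSpace X]
  [MeasurableSpace X] [BorelSpace X] {m : Measure (Marked X)} {π : Measure (Config X)}

/-- A function that is not a.e. measurable has zero push-forward, whereas a Poisson law is a
probability measure. -/
theorem IsPoisson.aemeasurable_count (hπ : IsPoisson m π) {A : Set (Marked X)}
    (hA : MeasurableSet A) (hc : IsCompact (closure A)) : AEMeasurable (Config.count A) π := by
  refine AEMeasurable.of_map_ne_zero ?_
  rw [hπ.map_count A hA hc]
  exact IsProbabilityMeasure.ne_zero _

variable {ι : Type*} [Fintype ι] {A : ι → Set (Marked X)}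

theorem IsPoisson.aemeasurable_counts (hπ : IsPoisson m π) (hA : ∀ i, MeasurableSet (A i))
    (hc : ∀ i, IsCompact (closure (A i))) :
    AEMeasurable (fun γ i => Config.count (A i) γ) π :=
  aemeasurable_pi_lambda _ fun i => hπ.aemeasurable_count (hA i) (hc i)

theorem IsPoisson.map_counts (hπ : IsPoisson m π) (hA : ∀ i, MeasurableSet (A i))
    (hc : ∀ i, IsCompact (closure (A i))) (hd : Pairwise fun i j => Disjoint (A i) (A j)) :
    π.map (fun γ i => Config.count (A i) γ) =
      Measure.pi fun i => poissonMeasure (m (A i)).toNNReal := by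
  have := hπ.isProbabilityMeasure
  let e := Fintype.equivFin ι
  have h := hπ.iIndepFun_count (Fintype.card ι) (fun k => A (e.symm k)) (fun k => hA _)
    (fun k => hc _) fun k l hkl => hd fun h => hkl (e.symm.injective h)
  have h' := h.precomp e.injective
  simp only [Equiv.symm_apply_apply] at h'
  rw [(iIndepFun_iff_map_fun_eq_pi_map fun i => hπ.aemeasurable_count (hA i) (hc i)).1 h']
  congr 1
  funext i
  exact hπ.map_count _ (hA i) (hc i)

variable [DecidableEq ι]

theorem IsPoisson.lintegral_count_mul [IsFiniteMeasureOnCompacts m] (hπ : IsPoisson m π)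
    (hA : ∀ i, MeasurableSet (A i))
    (hc : ∀ i, IsCompact (closure (A i))) (hd : Pairwise fun i j => Disjoint (A i) (A j))
    (i : ι) (H : (ι → ℕ) → ℝ≥0∞) :
    ∫⁻ γ, (Config.count (A i) γ : ℝ≥0∞) * H (fun j => Config.count (A j) γ) ∂π =
      m (A i) * ∫⁻ γ, H ((fun j => Config.count (A j) γ) + Pi.single i 1) ∂π := by
  have hm := hπ.aemeasurable_counts hA hc
  have hfin : m (A i) ≠ ∞ := ((measure_mono subset_closure).trans_lt (hc i).measure_lt_top).ne
  have h := lintegral_mul_pi_poissonMeasure (fun i => (m (A i)).toNNReal) i H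
  rw [← hπ.map_counts hA hc hd, lintegral_map' (measurable_of_countable _).aemeasurable hm,
    lintegral_map' (measurable_of_countable _).aemeasurable hm, ENNReal.coe_toNNReal hfin] at h
  exact h

theorem IsPoisson.integral_count_mul [IsFiniteMeasureOnCompacts m] (hπ : IsPoisson m π)
    (hA : ∀ i, MeasurableSet (A i))
    (hc : ∀ i, IsCompact (closure (A i))) (hd : Pairwise fun i j => Disjoint (A i) (A j))
    (i : ι) (H : (ι → ℕ) → ℝ) :
    ∫ γ, (Config.count (A i) γ : ℝ) * H (fun j => Config.count (A j) γ) ∂π =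
      m.real (A i) * ∫ γ, H ((fun j => Config.count (A j) γ) + Pi.single i 1) ∂π := by
  have hm := hπ.aemeasurable_counts hA hc
  have h := integral_mul_pi_poissonMeasure (fun i => (m (A i)).toNNReal) i H
  rw [← hπ.map_counts hA hc hd,
    integral_map hm (measurable_of_countable _).aestronglyMeasurable,
    integral_map hm (measurable_of_countable _).aestronglyMeasurable] at h
  exact h

theorem IsPoisson.lintegral_count [IsFiniteMeasureOnCompacts m] (hπ : IsPoisson m π)
    {B : Set (Marked X)} (hB : MeasurableSet B) (hc : IsCompact (closure B)) :
    ∫⁻ γ, (Config.count B γ : ℝ≥0∞) ∂π = m B := by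
  have := hπ.isProbabilityMeasure
  have h := hπ.lintegral_count_mul (A := fun _ : Unit => B) (fun _ => hB) (fun _ => hc)
    (fun i j hij => (hij rfl).elim) () (fun _ => 1)
  simpa using h

/-- The shift identity with `H(k) = k - 1` reduces this to the mean. The truncated subtraction at
`0` is harmless, as the other factor is then `0`. -/
theorem IsPoisson.lintegral_count_mul_count_sub_one [IsFiniteMeasureOnCompacts m]
    (hπ : IsPoisson m π) {B : Set (Marked X)} (hB : MeasurableSet B)
    (hc : IsCompact (closure B)) :
    ∫⁻ γ, (Config.count B γ : ℝ≥0∞) * ((Config.count B γ - 1 : ℕ) : ℝ≥0∞) ∂π = m B * m B := by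
  have h := hπ.lintegral_count_mul (A := fun _ : Unit => B) (fun _ => hB) (fun _ => hc)
    (fun i j hij => (hij rfl).elim) () (fun ω => ((ω () - 1 : ℕ) : ℝ≥0∞))
  simpa [hπ.lintegral_count hB hc] using h

theorem IsPoisson.integrable_count [IsFiniteMeasureOnCompacts m] (hπ : IsPoisson m π)
    {B : Set (Marked X)} (hB : MeasurableSet B) (hc : IsCompact (closure B)) :
    Integrable (fun γ => (Config.count B γ : ℝ)) π := by
  refine ⟨((measurable_of_countable (fun k : ℕ => (k : ℝ))).comp_aemeasurable
    (hπ.aemeasurable_count hB hc)).aestronglyMeasurable, ?_⟩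
  rw [HasFiniteIntegral]
  simp only [Real.enorm_natCast]
  rw [hπ.lintegral_count hB hc]
  exact (measure_mono subset_closure).trans_lt hc.measure_lt_top

end Counts

/-! ### The Mecke identity for compactly supported integrands -/

section Mecke

theorem integral_comp_simpleFunc {α β E : Type*} [MeasurableSpace α] [NormedAddCommGroup E]
    [NormedSpace ℝ E] [CompleteSpace E] (μ : Measure α) [IsFiniteMeasure μ] (s : SimpleFunc α β)
    (g : β → E) :
    ∫ x, g (s x) ∂μ = ∑ r : s.range, μ.real (s ⁻¹' {r.1}) • g r := by
  classical
  have h : ∀ x, g (s x) = ∑ r ∈ s.range, (s ⁻¹' {r}).indicator (fun _ => g r) x := by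
    intro x
    rw [Finset.sum_eq_single (s x)]
    · simp
    · intro r _ hr
      exact Set.indicator_of_notMem (fun h => hr (Eq.symm h)) _
    · exact fun h => (h (SimpleFunc.mem_range_self _ _)).elim
  simp_rw [h]
  rw [integral_finsetSum _ fun r _ =>
    (integrable_const _).indicator (s.measurableSet_preimage _),
    ← Finset.sum_coe_sort]
  exact Finset.sum_congr rfl fun r _ => integral_indicator_const _ (s.measurableSet_preimage _)

variable {X : Type*} [TopologicalSpace X] [PolishSpace X] [LocallyCompactSpace X]
  [MeasurableSpace X] [BorelSpace X] {m : Measure (Marked X)} {π : Measure (Config X)}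
  {E : Type*} [NormedAddCommGroup E] [NormedSpace ℝ E] [CompleteSpace E]

/-- For a simple `s`, all integrals over `γ ∩ S` are functions of the counts in the level sets of
`s`. Adding one point to the level set of the value `r` shifts `∫ (s z).2` by `r.2`, so the claim is
the shift identity summed over the values. Functions of the counts live on a countable space, hence
`K` needs no regularity. -/
theorem IsPoisson.mecke_simpleFunc [IsFiniteMeasureOnCompacts m] (hπ : IsPoisson m π)
    {S : Set (Marked X)} (hS : IsCompact S) (s : SimpleFunc (Marked X) (ℝ × E))
    (K : E → E → ℝ) {B : ℝ} (hK : ∀ p q, |K p q| ≤ B) :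
    (∀ q, AEStronglyMeasurable (fun γ : Config X =>
      K (∫ y, (s y).2 ∂(γ.toMeasure.restrict S)) q) π) ∧
    AEStronglyMeasurable (fun γ : Config X => ∫ y, (s y).1 *
      K (∫ z, (s z).2 ∂(γ.toMeasure.restrict S) - (s y).2) (s y).2 ∂(γ.toMeasure.restrict S)) π ∧
    ∫ γ : Config X, ∫ y, (s y).1 *
      K (∫ z, (s z).2 ∂(γ.toMeasure.restrict S) - (s y).2) (s y).2
        ∂(γ.toMeasure.restrict S) ∂π =
    ∫ y, (s y).1 * ∫ γ : Config X, K (∫ z, (s z).2 ∂(γ.toMeasure.restrict S)) (s y).2 ∂π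
      ∂(m.restrict S) := by
  classical
  have := hπ.isProbabilityMeasure
  have hfinN : ∀ γ : Config X, IsFiniteMeasure (γ.toMeasure.restrict S) :=
    fun γ => ⟨by rw [Measure.restrict_apply_univ]; exact hS.measure_lt_top⟩
  have hfinm : IsFiniteMeasure (m.restrict S) :=
    ⟨by rw [Measure.restrict_apply_univ]; exact hS.measure_lt_top⟩
  let A : s.range → Set (Marked X) := fun r => s ⁻¹' {r.1} ∩ S
  have hA : ∀ r, MeasurableSet (A r) :=
    fun r => (s.measurableSet_preimage _).inter hS.isClosed.measurableSet
  have hc : ∀ r, IsCompact (closure (A r)) := fun r => hS.closure_of_subset inter_subset_right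
  have hd : Pairwise fun r r' => Disjoint (A r) (A r') := by
    intro r r' h
    refine Disjoint.mono inter_subset_left inter_subset_left (Disjoint.preimage _ ?_)
    exact disjoint_singleton.2 fun h' => h (Subtype.ext h')
  have hcount : ∀ (γ : Config X) (r : s.range),
      (γ.toMeasure.restrict S).real (s ⁻¹' {r.1}) = Config.count (A r) γ := by
    intro γ r
    rw [measureReal_def, Measure.restrict_apply (s.measurableSet_preimage _),
      γ.toMeasure_apply_eq_count (hA r) (hc r), ENNReal.toReal_natCast]
  let Q : (s.range → ℕ) → E := fun ω => ∑ r, (ω r : ℝ) • r.1.2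
  have hQ : ∀ γ : Config X, ∫ y, (s y).2 ∂(γ.toMeasure.restrict S) =
      Q fun r => Config.count (A r) γ := by
    intro γ
    rw [integral_comp_simpleFunc _ s (fun r => r.2)]
    exact Finset.sum_congr rfl fun r _ => by rw [hcount]
  have hQs : ∀ ω r, Q (ω + Pi.single r 1) = Q ω + r.1.2 := by
    intro ω r
    simp only [Q, Pi.add_apply, Nat.cast_add, add_smul, Finset.sum_add_distrib]
    congr 1
    rw [Finset.sum_eq_single r]
    · simp
    · intro r' _ h
      simp [h]
    · simp
  have hm := hπ.aemeasurable_counts hA hc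
  have hH : ∀ H : (s.range → ℕ) → ℝ,
      AEStronglyMeasurable (fun γ => H fun r => Config.count (A r) γ) π := fun H =>
    ((measurable_of_countable H).comp_aemeasurable hm).aestronglyMeasurable
  have hJ : ∀ γ : Config X, ∫ y, (s y).1 *
      K (∫ z, (s z).2 ∂(γ.toMeasure.restrict S) - (s y).2) (s y).2 ∂(γ.toMeasure.restrict S) =
      ∑ r, (Config.count (A r) γ : ℝ) *
        (r.1.1 * K (Q (fun r => Config.count (A r) γ) - r.1.2) r.1.2) := by
    intro γ
    rw [hQ, integral_comp_simpleFunc _ s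
      (fun r => r.1 * K (Q (fun r => Config.count (A r) γ) - r.2) r.2)]
    exact Finset.sum_congr rfl fun r _ => by rw [hcount, smul_eq_mul]
  simp_rw [hJ, hQ]
  refine ⟨fun q => hH fun ω => K (Q ω) q, hH fun ω => ∑ r, (ω r : ℝ) *
    (r.1.1 * K (Q ω - r.1.2) r.1.2), ?_⟩
  rw [integral_finsetSum]
  · rw [integral_comp_simpleFunc (m.restrict S) s
      (fun r => r.1 * ∫ γ, K (Q fun r => Config.count (A r) γ) r.2 ∂π)]
    refine Finset.sum_congr rfl fun r _ => ?_
    rw [hπ.integral_count_mul hA hc hd r fun ω => r.1.1 * K (Q ω - r.1.2) r.1.2,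
      measureReal_def (m.restrict S), Measure.restrict_apply (s.measurableSet_preimage _),
      ← measureReal_def, smul_eq_mul, integral_const_mul]
    simp_rw [hQs, add_sub_cancel_right]
    rfl
  · intro r _
    refine (hπ.integrable_count (hA r) (hc r)).mul_bdd (c := |r.1.1| * B)
      (hH fun ω => r.1.1 * K (Q ω - r.1.2) r.1.2) (ae_of_all _ fun γ => ?_)
    rw [Real.norm_eq_abs, abs_mul]
    exact mul_le_mul_of_nonneg_left (hK _ _) (abs_nonneg _)

/-- Simple approximation on a compact set `S` containing both supports. There the restricted
counting measures are finite, so constants dominate the inner integrals, and a multiple of the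
integrable count `|γ ∩ S|` dominates the outer one. -/
theorem IsPoisson.mecke_compactlySupported [IsFiniteMeasureOnCompacts m] (hπ : IsPoisson m π)
    (v : C_c(Marked X, ℝ)) (Φ : C_c(Marked X, E))
    (K : E → E → ℝ) (hKc : Continuous (Function.uncurry K)) {B : ℝ} (hK : ∀ p q, |K p q| ≤ B) :
    (∀ q, AEStronglyMeasurable (fun γ : Config X => K (∫ z, Φ z ∂γ.toMeasure) q) π) ∧
    Integrable (fun γ : Config X =>
      ∫ y, v y * K (∫ z, Φ z ∂γ.toMeasure - Φ y) (Φ y) ∂γ.toMeasure) π ∧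
    ∫ γ : Config X, ∫ y, v y * K (∫ z, Φ z ∂γ.toMeasure - Φ y) (Φ y) ∂γ.toMeasure ∂π =
      ∫ y, v y * ∫ γ : Config X, K (∫ z, Φ z ∂γ.toMeasure) (Φ y) ∂π ∂m := by
  have := hπ.isProbabilityMeasure
  set S : Set (Marked X) := tsupport v ∪ tsupport Φ
  have hS : IsCompact S := v.hasCompactSupport.isCompact.union Φ.hasCompactSupport.isCompact
  have hSm : MeasurableSet S := hS.isClosed.measurableSet
  have hv0 : ∀ y ∉ S, v y = 0 := fun y hy =>
    image_eq_zero_of_notMem_tsupport fun h => hy (Or.inl h)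
  have hΦ0 : ∀ y ∉ S, Φ y = 0 := fun y hy =>
    image_eq_zero_of_notMem_tsupport fun h => hy (Or.inr h)
  have hfinN : ∀ γ : Config X, IsFiniteMeasure (γ.toMeasure.restrict S) :=
    fun γ => ⟨by rw [Measure.restrict_apply_univ]; exact hS.measure_lt_top⟩
  have hfinm : IsFiniteMeasure (m.restrict S) :=
    ⟨by rw [Measure.restrict_apply_univ]; exact hS.measure_lt_top⟩
  -- The two functions are approximated jointly, so that a single simple function supplies the level
  -- sets for both.
  let f : Marked X → ℝ × E := fun y => (v y, Φ y)
  have hf : StronglyMeasurable f := (v.continuous.prodMk Φ.continuous).stronglyMeasurable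
  obtain ⟨c1, hc1⟩ := v.continuous.bounded_above_of_compact_support v.hasCompactSupport
  obtain ⟨c2, hc2⟩ := Φ.continuous.bounded_above_of_compact_support Φ.hasCompactSupport
  set C : ℝ := max 0 (max c1 c2)
  have hC0 : 0 ≤ C := le_max_left _ _
  have hfC : ∀ y, ‖f y‖ ≤ C := fun y => by
    refine (norm_prod_le_iff.2 ⟨(hc1 y).trans ?_, (hc2 y).trans ?_⟩)
    · exact (le_max_left _ _).trans (le_max_right _ _)
    · exact (le_max_right _ _).trans (le_max_right _ _)
  let s := hf.approxBounded C
  have hsC : ∀ n y, ‖s n y‖ ≤ C := fun n y => hf.norm_approxBounded_le hC0 n y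
  have hs : ∀ y, Tendsto (fun n => s n y) atTop (𝓝 (f y)) := fun y =>
    hf.tendsto_approxBounded_of_norm_le (hfC y)
  have hs1 : ∀ y, Tendsto (fun n => (s n y).1) atTop (𝓝 (v y)) := fun y =>
    (continuous_fst.tendsto _).comp (hs y)
  have hs2 : ∀ y, Tendsto (fun n => (s n y).2) atTop (𝓝 (Φ y)) := fun y =>
    (continuous_snd.tendsto _).comp (hs y)
  let P : Config X → E := fun γ => ∫ z, Φ z ∂γ.toMeasure
  let Pn : ℕ → Config X → E := fun n γ => ∫ z, (s n z).2 ∂(γ.toMeasure.restrict S)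
  have hPn : ∀ γ, Tendsto (fun n => Pn n γ) atTop (𝓝 (P γ)) := by
    intro γ
    have h : P γ = ∫ z, Φ z ∂(γ.toMeasure.restrict S) :=
      (setIntegral_eq_integral_of_forall_compl_eq_zero hΦ0).symm
    rw [h]
    refine tendsto_integral_of_dominated_convergence (fun _ => C)
      (fun n => ((s n).map Prod.snd).aestronglyMeasurable) (integrable_const _)
      (fun n => ae_of_all _ fun y => (norm_snd_le _).trans (hsC n y))
      (ae_of_all _ fun y => hs2 y)
  have hB0 : 0 ≤ B := (abs_nonneg _).trans (hK 0 0)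
  have hKn : ∀ γ y, Tendsto (fun n => K (Pn n γ - (s n y).2) (s n y).2) atTop
      (𝓝 (K (P γ - Φ y) (Φ y))) := fun γ y =>
    (hKc.tendsto (P γ - Φ y, Φ y)).comp (((hPn γ).sub (hs2 y)).prodMk_nhds (hs2 y))
  have hKn' : ∀ γ y, Tendsto (fun n => K (Pn n γ) (s n y).2) atTop
      (𝓝 (K (P γ) (Φ y))) := fun γ y =>
    (hKc.tendsto (P γ, Φ y)).comp ((hPn γ).prodMk_nhds (hs2 y))
  have hbd : ∀ n y p q, ‖(s n y).1 * K p q‖ ≤ C * B := fun n y p q => by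
    rw [norm_mul]
    exact mul_le_mul ((norm_fst_le _).trans (hsC n y)) (hK _ _) (norm_nonneg _) hC0
  have hmecke := fun n => hπ.mecke_simpleFunc hS (s n) K hK
  let J : Config X → ℝ := fun γ => ∫ y, v y * K (P γ - Φ y) (Φ y) ∂γ.toMeasure
  let Jn : ℕ → Config X → ℝ := fun n γ => ∫ y, (s n y).1 * K (Pn n γ - (s n y).2) (s n y).2
    ∂(γ.toMeasure.restrict S)
  have hJn : ∀ γ, Tendsto (fun n => Jn n γ) atTop (𝓝 (J γ)) := by
    intro γ
    have h : J γ = ∫ y, v y * K (P γ - Φ y) (Φ y) ∂(γ.toMeasure.restrict S) :=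
      (setIntegral_eq_integral_of_forall_compl_eq_zero fun y hy => by
        rw [hv0 y hy, zero_mul]).symm
    rw [h]
    refine tendsto_integral_of_dominated_convergence (fun _ => C * B)
      (fun n => ((s n).map fun r : ℝ × E => r.1 * K (Pn n γ - r.2) r.2).aestronglyMeasurable)
      (integrable_const _) (fun n => ae_of_all _ fun y => hbd n y _ _)
      (ae_of_all _ fun y => (hs1 y).mul (hKn γ y))
  have hScl : IsCompact (closure S) := by rwa [hS.isClosed.closure_eq]
  have hbound : ∀ n γ, ‖Jn n γ‖ ≤ C * B * Config.count S γ := by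
    intro n γ
    have h := norm_integral_le_of_norm_le_const (μ := γ.toMeasure.restrict S)
      (ae_of_all _ fun y => hbd n y (Pn n γ - (s n y).2) (s n y).2)
    rwa [measureReal_restrict_apply_univ, measureReal_def,
      γ.toMeasure_apply_eq_count hSm hScl, ENNReal.toReal_natCast] at h
  have hint : Integrable (fun γ => C * B * (Config.count S γ : ℝ)) π :=
    (hπ.integrable_count hSm hScl).const_mul _
  have hJlim := tendsto_integral_of_dominated_convergence _ (fun n => (hmecke n).2.1) hint
    (fun n => ae_of_all _ (hbound n)) (ae_of_all _ hJn)
  refine ⟨fun q => aestronglyMeasurable_of_tendsto_ae atTop (fun n => (hmecke n).1 q)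
    (ae_of_all _ fun γ => (hKc.tendsto (P γ, q)).comp ((hPn γ).prodMk_nhds tendsto_const_nhds)),
    hint.mono' (aestronglyMeasurable_of_tendsto_ae atTop (fun n => (hmecke n).2.1)
    (ae_of_all _ hJn)) (ae_of_all _ fun γ => le_of_tendsto (hJn γ).norm
      (Eventually.of_forall fun n => hbound n γ)), tendsto_nhds_unique hJlim ?_⟩
  have hR : ∫ y, v y * ∫ γ : Config X, K (P γ) (Φ y) ∂π ∂m =
      ∫ y, v y * ∫ γ : Config X, K (P γ) (Φ y) ∂π ∂(m.restrict S) :=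
    (setIntegral_eq_integral_of_forall_compl_eq_zero fun y hy => by
      rw [hv0 y hy, zero_mul]).symm
  rw [hR]
  simp_rw [fun n => (hmecke n).2.2]
  have hinner : ∀ n y, ‖∫ γ : Config X, K (Pn n γ) (s n y).2 ∂π‖ ≤ B := fun n y => by
    simpa using norm_integral_le_of_norm_le_const (μ := π)
      (f := fun γ => K (Pn n γ) (s n y).2) (ae_of_all _ fun γ => hK _ _)
  refine tendsto_integral_of_dominated_convergence (fun _ => C * B)
    (fun n => ((s n).map fun r : ℝ × E => r.1 * ∫ γ, K (Pn n γ) r.2 ∂π).aestronglyMeasurable)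
    (integrable_const _) (fun n => ae_of_all _ fun y => ?_) (ae_of_all _ fun y => ?_)
  · rw [norm_mul]
    exact mul_le_mul ((norm_fst_le _).trans (hsC n y)) (hinner n y) (norm_nonneg _) hC0
  · refine (hs1 y).mul (tendsto_integral_of_dominated_convergence (fun _ => B)
      (fun n => (hmecke n).1 _) (integrable_const _) (fun n => ae_of_all _ fun γ => hK _ _)
      (ae_of_all _ fun γ => hKn' γ y))

end Mecke

/-! ### Campbell's bound and the Mecke identity for integrable weights -/

section MeckeIntegrable

variable {X : Type*} [TopologicalSpace X] [PolishSpace X] [LocallyCompactSpace X]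
  [MeasurableSpace X] [BorelSpace X] {m : Measure (Marked X)} {π : Measure (Config X)}

/-- Campbell's bound on the mean of `∑_{y ∈ γ} |w(y)|`. -/
theorem IsPoisson.exists_lintegral_le [IsFiniteMeasureOnCompacts m] (hπ : IsPoisson m π)
    (w : C(Marked X, ℝ)) (hw : Integrable w m) :
    ∃ u : Config X → ℝ≥0∞, Measurable u ∧ ∫⁻ γ, u γ ∂π ≠ ∞ ∧
      ∀ γ : Config X, ∫⁻ y, ‖w y‖ₑ ∂γ.toMeasure ≤ u γ := by
  obtain ⟨χ, h01, h1⟩ := exists_cutoff (Marked X)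
  let w' : C(Marked X, ℝ) := ⟨fun y => |w y|, by fun_prop⟩
  let v : ℕ → C_c(Marked X, ℝ) := fun k => cutoffMul (χ k) w'
  have hv : ∀ k y, v k y = χ k y * |w y| := fun k y => rfl
  have hv0 : ∀ k y, 0 ≤ v k y := fun k y => mul_nonneg (h01 k y).1 (abs_nonneg _)
  have hvN : ∀ k (γ : Config X), ∫⁻ y, ENNReal.ofReal (v k y) ∂γ.toMeasure =
      ENNReal.ofReal (∫ y, v k y ∂γ.toMeasure) := fun k γ =>
    (ofReal_integral_eq_lintegral_ofReal (integrable_compactlySupported _ _)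
      (ae_of_all _ (hv0 k))).symm
  have hmeas : ∀ k, Measurable fun γ : Config X =>
      ∫⁻ y, ENNReal.ofReal (v k y) ∂γ.toMeasure := fun k => by
    simp_rw [hvN]
    exact (Config.measurable_integral _).ennreal_ofReal
  -- The liminf of truncated integrals is a measurable majorant. Fatou's lemma is used twice: under
  -- `π` to bound its mean, and under each `γ` to compare it with the full integral.
  refine ⟨fun γ => liminf (fun k => ∫⁻ y, ENNReal.ofReal (v k y) ∂γ.toMeasure) atTop,
    Measurable.liminf hmeas, ?_, fun γ => ?_⟩
  · refine ((lintegral_liminf_le hmeas).trans_lt ?_).ne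
    have hle : ∀ k, ∫⁻ γ : Config X, ∫⁻ y, ENNReal.ofReal (v k y) ∂γ.toMeasure ∂π ≤
        ENNReal.ofReal (∫ y, |w y| ∂m) := by
      intro k
      -- With `Φ = 0` and `K = 1` the Mecke identity reduces to Campbell's formula.
      obtain ⟨-, hi, heq⟩ := hπ.mecke_compactlySupported (v k) (0 : C_c(Marked X, ℝ))
        (fun _ _ => 1) continuous_const (B := 1) (by simp)
      have := hπ.isProbabilityMeasure
      simp only [mul_one, integral_const, smul_eq_mul, probReal_univ] at hi heq
      simp_rw [hvN]
      rw [← ofReal_integral_eq_lintegral_ofReal hi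
        (ae_of_all _ fun γ => integral_nonneg (hv0 k)), heq]
      refine ENNReal.ofReal_le_ofReal (integral_mono (integrable_compactlySupported _ _) hw.abs
        fun y => ?_)
      exact mul_le_of_le_one_left (abs_nonneg _) (h01 k y).2
    exact (liminf_le_of_le (by isBoundedDefault) fun b hb => by
      obtain ⟨k, hk⟩ := hb.exists
      exact hk.trans (hle k)).trans_lt ENNReal.ofReal_lt_top
  · refine le_trans (le_of_eq (lintegral_congr fun y => ?_)) (lintegral_liminf_le fun k =>
      (v k).continuous.measurable.ennreal_ofReal)
    have h := ((tendsto_cutoff h1 y).mul_const |w y|)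
    rw [one_mul] at h
    rw [Real.enorm_eq_ofReal_abs]
    exact ((ENNReal.continuous_ofReal.tendsto _).comp h).liminf_eq.symm

variable {E : Type*} [NormedAddCommGroup E] [NormedSpace ℝ E] [CompleteSpace E]

theorem IsPoisson.ae_integrable [IsFiniteMeasureOnCompacts m] (hπ : IsPoisson m π)
    (w : C(Marked X, ℝ)) (hw : Integrable w m) : ∀ᵐ γ ∂π, Integrable w γ.toMeasure := by
  obtain ⟨u, hu, hfin, hle⟩ := hπ.exists_lintegral_le w hw
  filter_upwards [ae_lt_top hu hfin] with γ hγ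
  exact ⟨w.continuous.measurable.aestronglyMeasurable, (hle γ).trans_lt hγ⟩

/-- The weight is truncated to `χ_k w`. Since `|χ_k w| ≤ |w|` and `K` is bounded, the majorant `u`
of Campbell's bound dominates the truncated sums uniformly in `k`. -/
theorem IsPoisson.mecke [IsFiniteMeasureOnCompacts m] (hπ : IsPoisson m π)
    (w : C(Marked X, ℝ)) (hw : Integrable w m) (Φ : C_c(Marked X, E))
    (K : E → E → ℝ) (hKc : Continuous (Function.uncurry K)) {B : ℝ} (hK : ∀ p q, |K p q| ≤ B) :
    Integrable (fun γ : Config X =>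
      ∫ y, w y * K (∫ z, Φ z ∂γ.toMeasure - Φ y) (Φ y) ∂γ.toMeasure) π ∧
    ∫ γ : Config X, ∫ y, w y * K (∫ z, Φ z ∂γ.toMeasure - Φ y) (Φ y) ∂γ.toMeasure ∂π =
      ∫ y, w y * ∫ γ : Config X, K (∫ z, Φ z ∂γ.toMeasure) (Φ y) ∂π ∂m := by
  have := hπ.isProbabilityMeasure
  obtain ⟨χ, h01, h1⟩ := exists_cutoff (Marked X)
  obtain ⟨u, hu, hfin, hle⟩ := hπ.exists_lintegral_le w hw
  have hB0 : 0 ≤ B := (abs_nonneg _).trans (hK 0 0)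
  let v : ℕ → C_c(Marked X, ℝ) := fun k => cutoffMul (χ k) w
  have hv : ∀ k y, v k y = χ k y * w y := fun k y => rfl
  have hvw : ∀ k y, ‖v k y‖ ≤ ‖w y‖ := fun k y => by
    rw [hv, norm_mul, Real.norm_of_nonneg (h01 k y).1]
    exact mul_le_of_le_one_left (norm_nonneg _) (h01 k y).2
  have hvlim : ∀ y, Tendsto (fun k => v k y) atTop (𝓝 (w y)) := fun y => by
    have h := (tendsto_cutoff h1 y).mul_const (w y)
    rwa [one_mul] at h
  have hmecke := fun k => hπ.mecke_compactlySupported (v k) Φ K hKc hK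
  have hvK : ∀ k y p q, ‖v k y * K p q‖ ≤ ‖w y‖ * B := fun k y p q => by
    rw [norm_mul]
    exact mul_le_mul (hvw k y) (hK _ _) (norm_nonneg _) (norm_nonneg _)
  have hK1 : ∀ (γ : Config X), Continuous fun y =>
      K (∫ z, Φ z ∂γ.toMeasure - Φ y) (Φ y) := fun γ =>
    hKc.comp ((continuous_const.sub Φ.continuous).prodMk Φ.continuous)
  have hint : Integrable (fun γ => (u γ).toReal * B) π :=
    (integrable_toReal_of_lintegral_ne_top hu.aemeasurable hfin).mul_const _
  have hbound : ∀ k, ∀ᵐ γ : Config X ∂π,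
      ‖∫ y, v k y * K (∫ z, Φ z ∂γ.toMeasure - Φ y) (Φ y) ∂γ.toMeasure‖ ≤
        (u γ).toReal * B := by
    intro k
    filter_upwards [hπ.ae_integrable w hw, ae_lt_top hu hfin] with γ hγ huγ
    refine (norm_integral_le_of_norm_le (hγ.norm.mul_const B)
      (ae_of_all _ fun y => hvK k y _ _)).trans ?_
    rw [integral_mul_const]
    refine mul_le_mul_of_nonneg_right ?_ hB0
    rw [integral_norm_eq_lintegral_enorm hγ.aestronglyMeasurable]
    exact ENNReal.toReal_mono huγ.ne (hle γ)
  have hlim : ∀ᵐ γ : Config X ∂π, Tendsto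
      (fun k => ∫ y, v k y * K (∫ z, Φ z ∂γ.toMeasure - Φ y) (Φ y) ∂γ.toMeasure) atTop
      (𝓝 (∫ y, w y * K (∫ z, Φ z ∂γ.toMeasure - Φ y) (Φ y) ∂γ.toMeasure)) := by
    filter_upwards [hπ.ae_integrable w hw] with γ hγ
    exact tendsto_integral_of_dominated_convergence (fun y => ‖w y‖ * B)
      (fun k => ((v k).continuous.mul (hK1 γ)).measurable.aestronglyMeasurable)
      (hγ.norm.mul_const B) (fun k => ae_of_all _ fun y => hvK k y _ _)
      (ae_of_all _ fun y => (hvlim y).mul_const _)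
  have hJlim := tendsto_integral_of_dominated_convergence _
    (fun k => (hmecke k).2.1.aestronglyMeasurable) hint hbound hlim
  refine ⟨hint.mono' (aestronglyMeasurable_of_tendsto_ae atTop
    (fun k => (hmecke k).2.1.aestronglyMeasurable) hlim) ?_, tendsto_nhds_unique hJlim ?_⟩
  · filter_upwards [hlim, ae_all_iff.2 hbound] with γ h2 h3
    exact le_of_tendsto h2.norm (Eventually.of_forall h3)
  simp_rw [fun k => (hmecke k).2.2]
  -- Continuity in `y` supplies the measurability needed for dominated convergence under `m`.
  have hcont : Continuous fun y => ∫ γ : Config X, K (∫ z, Φ z ∂γ.toMeasure) (Φ y) ∂π :=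
    continuous_of_dominated (bound := fun _ => B) (fun y => (hmecke 0).1 _)
      (fun y => ae_of_all _ fun γ => hK _ _) (integrable_const _)
      (ae_of_all _ fun γ => hKc.comp (continuous_const.prodMk Φ.continuous))
  refine tendsto_integral_of_dominated_convergence (fun y => ‖w y‖ * B)
    (fun k => ((v k).continuous.mul hcont).measurable.aestronglyMeasurable)
    (hw.norm.mul_const B) (fun k => ae_of_all _ fun y => ?_)
    (ae_of_all _ fun y => (hvlim y).mul_const _)
  rw [norm_mul]
  refine mul_le_mul (hvw k y) ?_ (norm_nonneg _) (norm_nonneg _)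
  simpa using norm_integral_le_of_norm_le_const (μ := π)
    (f := fun γ : Config X => K (∫ z, Φ z ∂γ.toMeasure) (Φ y)) (ae_of_all _ fun γ => hK _ _)

end MeckeIntegrable

/-! ### The Poisson measure is carried by `Π(𝕏)` -/

section Pinpointing

variable {X : Type*} [TopologicalSpace X] [PolishSpace X] [LocallyCompactSpace X]
  [MeasurableSpace X] [BorelSpace X] {ν : Measure Weight} [IsLocallyFiniteMeasure ν]
  {σ : Measure X} [IsLocallyFiniteMeasure σ] {π : Measure (Config X)}

/-- Without atoms, outer regularity gives every point an open neighbourhood of measure below `ε`.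
Countably many of these cover by the Lindelöf property and are then made disjoint. -/
theorem exists_partition_measure_le [NullSingletonClass σ] {L : Set X}
    (hL : MeasurableSet L) {ε : ℝ≥0∞} (hε : 0 < ε) :
    ∃ B : ℕ → Set X, (∀ k, MeasurableSet (B k)) ∧ (∀ k, B k ⊆ L) ∧ (∀ k, σ (B k) ≤ ε) ∧
      L ⊆ ⋃ k, B k ∧ ∑' k, σ (B k) ≤ σ L := by
  have h : ∀ x : X, ∃ U ⊇ ({x} : Set X), IsOpen U ∧ σ U < ε := fun x =>
    Set.exists_isOpen_lt_of_lt {x} ε (by rwa [measure_singleton])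
  choose U hxU hU hUε using h
  obtain ⟨s, hs, hcov⟩ := TopologicalSpace.countable_cover_nhds
    fun x => (hU x).mem_nhds (hxU x rfl)
  obtain ⟨V, hV, hVε, hVcov⟩ : ∃ V : ℕ → Set X, (∀ k, MeasurableSet (V k)) ∧
      (∀ k, σ (V k) ≤ ε) ∧ ⋃ k, V k = univ := by
    rcases s.eq_empty_or_nonempty with rfl | hne
    · refine ⟨fun _ => ∅, by simp, by simp, ?_⟩
      simpa using hcov
    · obtain ⟨f, rfl⟩ := hs.exists_eq_range hne
      refine ⟨fun k => U (f k), fun k => (hU _).measurableSet, fun k => (hUε _).le, ?_⟩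
      simpa using hcov
  refine ⟨fun k => L ∩ disjointed V k, fun k => hL.inter (MeasurableSet.disjointed hV k),
    fun k => inter_subset_left,
    fun k => (measure_mono (inter_subset_right.trans (disjointed_subset V k))).trans (hVε k),
    ?_, ?_⟩
  · rw [← inter_iUnion, iUnion_disjointed, hVcov, inter_univ]
  · rw [← measure_iUnion (fun i j hij => ((disjoint_disjointed V) hij).mono inter_subset_right
      inter_subset_right) fun k => hL.inter (MeasurableSet.disjointed hV k)]
    exact measure_mono (iUnion_subset fun k => inter_subset_left)

/-- Cut `L` into pieces `B_k` with `σ(B_k) ≤ 1/n`. Two points over one position fall into the same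
`I × B_k`, which by Markov's inequality for `N(N - 1)` has probability at most `(ν(I) σ(B_k))²`.
Summing over `k` gives at most `ν(I)² σ(L) / n`. -/
theorem IsPoisson.ae_injOn_inter [NullSingletonClass σ] (hπ : IsPoisson (ν.prod σ) π)
    {I : Set Weight} (hI : IsCompact I) {L : Set X} (hL : IsCompact L) :
    ∀ᵐ γ ∂π, InjOn Prod.snd (γ.1 ∩ I ×ˢ L) := by
  have hIL : IsCompact (I ×ˢ L) := hI.prod hL
  set c : ℝ≥0∞ := ν I * ν I * σ L
  have hc : c ≠ ∞ := ENNReal.mul_ne_top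
    (ENNReal.mul_ne_top hI.measure_lt_top.ne hI.measure_lt_top.ne) hL.measure_lt_top.ne
  have hle : ∀ n : ℕ, π {γ | ¬ InjOn Prod.snd (γ.1 ∩ I ×ˢ L)} ≤ c * (n : ℝ≥0∞)⁻¹ := by
    intro n
    obtain ⟨B, hB, hBL, hBε, hcov, hsum⟩ := exists_partition_measure_le (σ := σ)
      hL.isClosed.measurableSet (ENNReal.inv_pos.2 (ENNReal.natCast_ne_top n))
    have hIB : ∀ k, MeasurableSet (I ×ˢ B k) := fun k =>
      hI.isClosed.measurableSet.prod (hB k)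
    have hIBc : ∀ k, IsCompact (closure (I ×ˢ B k)) := fun k =>
      hIL.closure_of_subset (prod_mono_right (hBL k))
    have hsub : {γ : Config X | ¬ InjOn Prod.snd (γ.1 ∩ I ×ˢ L)} ⊆
        ⋃ k, {γ | 1 ≤ (Config.count (I ×ˢ B k) γ : ℝ≥0∞) *
          ((Config.count (I ×ˢ B k) γ - 1 : ℕ) : ℝ≥0∞)} := by
      intro γ hγ
      simp only [mem_ofPred_eq, InjOn, not_forall] at hγ
      obtain ⟨y, ⟨hy, hyI⟩, z, ⟨hz, hzI⟩, hyz, hne⟩ := hγ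
      obtain ⟨k, hk⟩ := mem_iUnion.1 (hcov hyI.2)
      have hfin : (γ.1 ∩ I ×ˢ B k).Finite :=
        (γ.finite_inter (hIBc k)).subset (inter_subset_inter_right _ subset_closure)
      have h2 : 1 < Config.count (I ×ˢ B k) γ := (one_lt_ncard_iff hfin).2
        ⟨y, z, ⟨hy, hyI.1, hk⟩, ⟨hz, hzI.1, hyz ▸ hk⟩, hne⟩
      refine mem_iUnion.2 ⟨k, ?_⟩
      change (1 : ℝ≥0∞) ≤ _
      rw [← Nat.cast_mul]
      exact_mod_cast Nat.mul_pos (by omega) (by omega)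
    calc π {γ : Config X | ¬ InjOn Prod.snd (γ.1 ∩ I ×ˢ L)}
        ≤ ∑' k, π {γ | 1 ≤ (Config.count (I ×ˢ B k) γ : ℝ≥0∞) *
          ((Config.count (I ×ˢ B k) γ - 1 : ℕ) : ℝ≥0∞)} :=
        (measure_mono hsub).trans (measure_iUnion_le _)
      _ ≤ ∑' k, ν I * ν I * (n : ℝ≥0∞)⁻¹ * σ (B k) := by
        refine ENNReal.tsum_le_tsum fun k => ?_
        have hm : AEMeasurable (fun γ => (Config.count (I ×ˢ B k) γ : ℝ≥0∞) *
            ((Config.count (I ×ˢ B k) γ - 1 : ℕ) : ℝ≥0∞)) π :=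
          (measurable_of_countable fun j : ℕ => (j : ℝ≥0∞) * ((j - 1 : ℕ) : ℝ≥0∞)).comp_aemeasurable
            (hπ.aemeasurable_count (hIB k) (hIBc k))
        have h := mul_meas_ge_le_lintegral₀ hm 1
        rw [one_mul, hπ.lintegral_count_mul_count_sub_one (hIB k) (hIBc k),
          Measure.prod_prod] at h
        refine h.trans ?_
        calc ν I * σ (B k) * (ν I * σ (B k)) = ν I * ν I * σ (B k) * σ (B k) := by ring
          _ ≤ ν I * ν I * (n : ℝ≥0∞)⁻¹ * σ (B k) := by gcongr; exact hBε k
      _ = ν I * ν I * (n : ℝ≥0∞)⁻¹ * ∑' k, σ (B k) := ENNReal.tsum_mul_left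
      _ ≤ ν I * ν I * (n : ℝ≥0∞)⁻¹ * σ L := by gcongr
      _ = c * (n : ℝ≥0∞)⁻¹ := by ring
  have hlim : Tendsto (fun n : ℕ => c * (n : ℝ≥0∞)⁻¹) atTop (𝓝 0) := by
    simpa using ENNReal.Tendsto.const_mul ENNReal.tendsto_inv_nat_nhds_zero (Or.inr hc)
  exact le_antisymm (ge_of_tendsto' hlim hle) bot_le

theorem integrable_weightMul (hν : Integrable (fun s : Weight => (s : ℝ)) ν) (f : C_c(X, ℝ)) :
    Integrable (weightMul f) (ν.prod σ) :=
  hν.mul_prod (integrable_compactlySupported f σ)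

theorem IsPoisson.ae_mem_pinpointing [NullSingletonClass σ]
    (hν : Integrable (fun s : Weight => (s : ℝ)) ν) (hπ : IsPoisson (ν.prod σ) π) :
    ∀ᵐ γ ∂π, γ ∈ pinpointing X := by
  let I := CompactExhaustion.choice Weight
  let K := CompactExhaustion.choice X
  choose f h01 h1 using fun n => exists_cutoff_of_isCompact (K.isCompact n)
  have hinj := ae_all_iff.2 fun n => hπ.ae_injOn_inter (I.isCompact n) (K.isCompact n)
  have hmass := ae_all_iff.2 fun n =>
    hπ.ae_integrable (weightMul (f n)) (integrable_weightMul hν (f n))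
  filter_upwards [hinj, hmass] with γ h2 h3
  refine ⟨fun y hy z hz hyz => ?_, fun Λ hΛ hc => ?_⟩
  -- Two points over the same position lie in one common product of the exhaustions.
  · obtain ⟨a, ha⟩ := I.exists_superset_of_isCompact (toFinite {y.1, z.1}).isCompact
    obtain ⟨b, hb⟩ := K.exists_mem y.2
    have hI := (I.subset (le_max_left a b))
    have hK := (K.subset (le_max_right a b))
    exact h2 (max a b) ⟨hy, hI (ha (by simp)), hK hb⟩ ⟨hz, hI (ha (by simp)), hK (hyz ▸ hb)⟩ hyz
  · obtain ⟨n, hn⟩ := K.exists_superset_of_isCompact hc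
    have hs := (γ.integrable_toMeasure_iff _).1 (h3 n)
    have hs' : ∑' y : γ.1, ENNReal.ofReal ‖weightMul (f n) y‖ ≠ ∞ := hs.tsum_ofReal_ne_top
    refine lt_of_le_of_lt (ENNReal.tsum_le_tsum fun y => ?_) hs'.lt_top
    by_cases hy : y.1.2 ∈ Λ
    · rw [indicator_of_mem hy]
      refine ENNReal.ofReal_le_ofReal ((le_of_eq ?_).trans (le_abs_self _))
      change _ = (y.1.1 : ℝ) * f n y.1.2
      rw [h1 n _ (hn (subset_closure hy)), mul_one]
    · rw [indicator_of_notMem hy]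
      exact bot_le

end Pinpointing

/-! ### Transfer of integrals from `Γ(𝕏)` to the cone -/

section Transfer

variable {X : Type*} [TopologicalSpace X] [PolishSpace X] [LocallyCompactSpace X]
  [MeasurableSpace X] [BorelSpace X] {π : Measure (Config X)}

/-- Only null measurability of `Π(𝕏)` is used, and it follows from `Π(𝕏)` having full measure. -/
theorem map_val_comap_val (hπ : ∀ᵐ γ ∂π, γ ∈ pinpointing X) :
    (π.comap (Subtype.val : pinpointing X → Config X)).map Subtype.val = π := by
  have hnull : NullMeasurableSet (pinpointing X) π := by
    have h : pinpointing X =ᵐ[π] univ := eventuallyEq_univ.2 hπ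
    exact MeasurableSet.univ.nullMeasurableSet.congr h.symm
  have himage : ∀ s, MeasurableSet s →
      NullMeasurableSet ((Subtype.val : pinpointing X → Config X) '' s) π := by
    rintro _ ⟨t, ht, rfl⟩
    rw [Subtype.image_preimage_coe]
    exact hnull.inter ht.nullMeasurableSet
  ext t ht
  rw [Measure.map_apply measurable_subtype_coe ht,
    Measure.comap_apply₀ _ _ Subtype.val_injective himage
      (measurable_subtype_coe ht).nullMeasurableSet, Subtype.image_preimage_coe]
  exact measure_congr (inter_eventuallyEq_right.2 (hπ.mono fun γ h _ => h))

/-- Since `ℛ` is a measurable embedding, measurability of `H` need not be checked on the cone: it is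
inherited from `u`. -/
theorem integrable_and_integral_coneMeasure (hπ : ∀ᵐ γ ∂π, γ ∈ pinpointing X) {H : Cone X → ℝ}
    {u : Config X → ℝ} (hu : Integrable u π)
    (h : ∀ γ : pinpointing X, H (coneEquiv X γ) = u γ) :
    Integrable H (coneMeasure π) ∧ ∫ η, H η ∂(coneMeasure π) = ∫ γ, u γ ∂π := by
  have he : MeasurableEmbedding (coneEquiv X) := (coneMeasurableEquiv X).measurableEmbedding
  have hcomp : H ∘ coneEquiv X = u ∘ Subtype.val := funext h
  have hu' : Integrable u ((π.comap (Subtype.val : pinpointing X → Config X)).map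
      Subtype.val) := by rwa [map_val_comap_val hπ]
  constructor
  · rw [coneMeasure, he.integrable_map_iff, hcomp]
    exact hu'.comp_measurable measurable_subtype_coe
  · rw [coneMeasure, he.integral_map]
    simp_rw [h]
    rw [← integral_map measurable_subtype_coe.aemeasurable hu'.aestronglyMeasurable,
      map_val_comap_val hπ]

end Transfer

/-! ### Effect of removing and adding an atom -/

section Atoms

variable {X : Type*} [TopologicalSpace X] [PolishSpace X] [LocallyCompactSpace X]
  [MeasurableSpace X] [BorelSpace X]

theorem Config.toMeasure_eq_add_dirac {γ γ' : Config X} {y : Marked X} (hy : y ∉ γ'.1)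
    (h : γ.1 = insert y γ'.1) : γ.toMeasure = γ'.toMeasure + Measure.dirac y := by
  ext A hA
  rw [Measure.add_apply, γ.toMeasure_apply hA, γ'.toMeasure_apply hA, Measure.dirac_apply' _ hA, h]
  by_cases hyA : y ∈ A
  · rw [insert_inter_of_mem hyA, encard_insert_of_notMem fun h => hy h.1, indicator_of_mem hyA]
    simp
  · rw [insert_inter_of_notMem hyA, indicator_of_notMem hyA, add_zero]

theorem Cone.atomSet_removeAtom (η : Cone X) {y : Marked X} (hy : y ∈ atomSet η.1) :
    y ∉ atomSet (η.removeAtom y.2).1 ∧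
      atomSet η.1 = insert y (atomSet (η.removeAtom y.2).1) := by
  have hself : (η.removeAtom y.2).1 {y.2} = 0 := by
    change η.1.restrict {y.2}ᶜ {y.2} = 0
    rw [Measure.restrict_apply (measurableSet_singleton _)]
    simp
  have hother : ∀ x, x ≠ y.2 → (η.removeAtom y.2).1 {x} = η.1 {x} := by
    intro x hx
    change η.1.restrict {y.2}ᶜ {x} = _
    rw [Measure.restrict_apply (measurableSet_singleton _),
      Set.inter_eq_left.2 (by simpa using hx.symm)]
  have hnot : ∀ z : Marked X, z.2 = y.2 → z ∉ atomSet (η.removeAtom y.2).1 := by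
    intro z hz h
    rw [atomSet, mem_ofPred_eq, hz, hself] at h
    exact ofReal_weight_ne_zero _ h.symm
  refine ⟨hnot y rfl, ?_⟩
  ext z
  by_cases hz : z.2 = y.2
  · rw [mem_insert_iff, or_iff_left (hnot z hz)]
    exact ⟨fun h => injOn_atomSet _ h hy hz, fun h => h ▸ hy⟩
  · rw [mem_insert_iff, or_iff_right fun h : z = y => hz (congrArg Prod.snd h)]
    change η.1 {z.2} = _ ↔ (η.removeAtom y.2).1 {z.2} = _
    rw [hother _ hz]

/-- The position must be free: at an existing atom the weights would add up, and the marked point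
would be moved instead of a new one being inserted. The excluded positions are countable, hence
`σ`-null. -/
theorem Cone.atomSet_addAtom (η : Cone X) {y : Marked X} (hy : η.1 {y.2} = 0) :
    y ∉ atomSet η.1 ∧ atomSet (η.addAtom y.1 y.2).1 = insert y (atomSet η.1) := by
  have hnot : ∀ z : Marked X, z.2 = y.2 → z ∉ atomSet η.1 := by
    intro z hz h
    rw [atomSet, mem_ofPred_eq, hz, hy] at h
    exact ofReal_weight_ne_zero _ h.symm
  refine ⟨hnot y rfl, ?_⟩
  ext z
  change (η.1 + ENNReal.ofReal (y.1 : ℝ) • Measure.dirac y.2) {z.2} = _ ↔ _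
  rw [Measure.add_apply, Measure.smul_apply, Measure.dirac_apply' _ (measurableSet_singleton _)]
  by_cases hz : z.2 = y.2
  · rw [mem_insert_iff, or_iff_left (hnot z hz), hz, hy]
    simp only [mem_singleton_iff, indicator_of_mem, Pi.one_apply, smul_eq_mul, mul_one, zero_add]
    exact ⟨fun h => Prod.ext (ofReal_weight_inj h.symm) hz, fun h => h ▸ rfl⟩
  · rw [mem_insert_iff, or_iff_right fun h : z = y => hz (congrArg Prod.snd h),
      indicator_of_notMem (by simpa using Ne.symm hz), smul_zero, add_zero]
    rfl

variable {E : Type*} [NormedAddCommGroup E] [NormedSpace ℝ E] [CompleteSpace E]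

theorem Config.integral_eq_add {γ γ' : Config X} {y : Marked X} (hy : y ∉ γ'.1)
    (h : γ.1 = insert y γ'.1) (Φ : C_c(Marked X, E)) :
    ∫ z, Φ z ∂γ.toMeasure = ∫ z, Φ z ∂γ'.toMeasure + Φ y := by
  rw [Config.toMeasure_eq_add_dirac hy h, integral_add_measure
    (integrable_compactlySupported Φ _) (integrable_compactlySupported Φ _), integral_dirac]

theorem Cone.integral_removeAtom (η : Cone X) {y : Marked X} (hy : y ∈ atomSet η.1)
    (Φ : C_c(Marked X, E)) : ∫ z, Φ z ∂(η.removeAtom y.2).toConfig.toMeasure =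
      ∫ z, Φ z ∂η.toConfig.toMeasure - Φ y := by
  obtain ⟨h1, h2⟩ := η.atomSet_removeAtom hy
  rw [Config.integral_eq_add (γ := η.toConfig) (γ' := (η.removeAtom y.2).toConfig) h1 h2,
    add_sub_cancel_right]

theorem Cone.integral_addAtom (η : Cone X) {y : Marked X} (hy : η.1 {y.2} = 0)
    (Φ : C_c(Marked X, E)) : ∫ z, Φ z ∂(η.addAtom y.1 y.2).toConfig.toMeasure =
      ∫ z, Φ z ∂η.toConfig.toMeasure + Φ y := by
  obtain ⟨h1, h2⟩ := η.atomSet_addAtom hy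
  exact Config.integral_eq_add (γ := (η.addAtom y.1 y.2).toConfig) (γ' := η.toConfig) h1 h2 Φ

theorem Cone.ae_apply_singleton_eq_zero (σ : Measure X) [NullSingletonClass σ] (η : Cone X) :
    ∀ᵐ x ∂σ, η.1 {x} = 0 := by
  obtain ⟨C, hC, h0⟩ := η.2.exists_countable
  filter_upwards [hC.ae_notMem σ] with x hx
  exact measure_mono_null (by simpa using hx) h0

end Atoms

/-! ### Cylinder functions through one vector-valued integral -/

section Cylinder

variable {X : Type*} [TopologicalSpace X] [PolishSpace X] [LocallyCompactSpace X]
  [MeasurableSpace X] [BorelSpace X]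

theorem Config.integral_apply {N : ℕ} (Φ : C_c(Marked X, Fin N → ℝ)) (γ : Config X) (i : Fin N) :
    (∫ y, Φ y ∂γ.toMeasure) i = ∫ y, Φ y i ∂γ.toMeasure :=
  eval_integral (fun j => (integrable_compactlySupported Φ γ.toMeasure).eval j) i

theorem IsCylinder.exists_vector {F : Cone X → ℝ} (hF : IsCylinder F) :
    ∃ (N : ℕ) (g : (Fin N → ℝ) →ᵇ ℝ) (Φ : C_c(Marked X, Fin N → ℝ)),
      ∀ η : Cone X, F η = g (∫ y, Φ y ∂η.toConfig.toMeasure) := by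
  obtain ⟨N, g, φ, h⟩ := hF
  let Φ : C_c(Marked X, Fin N → ℝ) := ⟨⟨fun y i => φ i y, by fun_prop⟩,
    HasCompactSupport.intro (isCompact_iUnion fun i => (φ i).hasCompactSupport.isCompact)
      fun y hy => by
        ext i
        exact image_eq_zero_of_notMem_tsupport (f := φ i) fun h => hy (mem_iUnion.2 ⟨i, h⟩)⟩
  refine ⟨N, g, Φ, fun η => ?_⟩
  rw [h]
  congr 1
  funext i
  rw [Config.integral_apply]
  rfl

theorem Config.measurable_integral_vector {N : ℕ} (Φ : C_c(Marked X, Fin N → ℝ)) :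
    Measurable fun γ : Config X => ∫ y, Φ y ∂γ.toMeasure := by
  refine measurable_pi_lambda _ fun i => ?_
  simp_rw [Config.integral_apply]
  let φ : C_c(Marked X, ℝ) := ⟨⟨fun y => Φ y i, by fun_prop⟩,
    Φ.hasCompactSupport.comp_left (g := fun q : Fin N → ℝ => q i) rfl⟩
  exact Config.measurable_integral φ

variable {N : ℕ} {F : Cone X → ℝ} {g : (Fin N → ℝ) →ᵇ ℝ} {Φ : C_c(Marked X, Fin N → ℝ)}
theorem deathGrad_eq (hF : ∀ η : Cone X, F η = g (∫ y, Φ y ∂η.toConfig.toMeasure))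
    (η : Cone X) {y : Marked X} (hy : y ∈ atomSet η.1) :
    deathGrad F η y.2 = g (∫ z, Φ z ∂η.toConfig.toMeasure - Φ y) -
      g (∫ z, Φ z ∂η.toConfig.toMeasure) := by
  rw [deathGrad, hF, hF, η.integral_removeAtom hy]

theorem birthGrad_eq (hF : ∀ η : Cone X, F η = g (∫ y, Φ y ∂η.toConfig.toMeasure))
    (η : Cone X) {y : Marked X} (hy : η.1 {y.2} = 0) :
    birthGrad F η y = g (∫ z, Φ z ∂η.toConfig.toMeasure + Φ y) -
      g (∫ z, Φ z ∂η.toConfig.toMeasure) := by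
  rw [birthGrad, hF, hF, η.integral_addAtom hy]

end Cylinder

/-! ### The derivatives on `Γ(𝕏)` and integration by parts -/

section Derivatives

variable {X : Type*} [TopologicalSpace X] [PolishSpace X] [LocallyCompactSpace X]
  [MeasurableSpace X] [BorelSpace X] {N : ℕ} {F : Cone X → ℝ} {g : (Fin N → ℝ) →ᵇ ℝ}
  {Φ : C_c(Marked X, Fin N → ℝ)}

theorem Cone.integrable_weightMul (η : Cone X) (h : C_c(X, ℝ)) :
    Integrable (weightMul h) η.toConfig.toMeasure :=
  integrable_mul_of_mem_pinpointing ((coneEquiv X).symm η).2 h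

theorem Cone.integral_eq (η : Cone X) (f : X → ℝ) :
    ∫ x, f x ∂η.1 = ∫ y, (y.1 : ℝ) * f y.2 ∂η.toConfig.toMeasure := by
  rw [← η.toConfig.integral_markedMeasure]
  congr 1
  exact η.markedMeasure_atomSet.symm

theorem integrable_deathGrad_mul (hF : ∀ η : Cone X, F η = g (∫ y, Φ y ∂η.toConfig.toMeasure))
    (h : C_c(X, ℝ)) (η : Cone X) : Integrable (fun x => deathGrad F η x * h x) η.1 := by
  rw [← η.markedMeasure_atomSet]
  refine (η.toConfig.integrable_markedMeasure_iff _).2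
    ((η.toConfig.integrable_toMeasure_iff _).2 ?_)
  have hs := (η.toConfig.integrable_toMeasure_iff _).1 (η.integrable_weightMul h)
  refine (hs.mul_left (2 * ‖g‖)).of_nonneg_of_le (fun _ => norm_nonneg _) fun y => ?_
  change ‖(y.1.1 : ℝ) * (deathGrad F η y.1.2 * h y.1.2)‖ ≤ 2 * ‖g‖ * ‖(y.1.1 : ℝ) * h y.1.2‖
  rw [mul_left_comm, norm_mul]
  refine mul_le_mul_of_nonneg_right ?_ (norm_nonneg _)
  rw [deathGrad, hF, hF]
  exact (norm_sub_le _ _).trans (by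
    rw [two_mul]; exact add_le_add (g.norm_coe_le_norm _) (g.norm_coe_le_norm _))

theorem deathDeriv_eq (hF : ∀ η : Cone X, F η = g (∫ y, Φ y ∂η.toConfig.toMeasure))
    (h : C_c(X, ℝ)) (η : Cone X) :
    deathDeriv h F η =
      ∫ y, weightMul h y * g (∫ z, Φ z ∂η.toConfig.toMeasure - Φ y) ∂η.toConfig.toMeasure -
      g (∫ z, Φ z ∂η.toConfig.toMeasure) * ∫ y, weightMul h y ∂η.toConfig.toMeasure := by
  set P := ∫ z, Φ z ∂η.toConfig.toMeasure
  have hw := η.integrable_weightMul h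
  have h1 : Integrable (fun y => weightMul h y * g (P - Φ y)) η.toConfig.toMeasure :=
    hw.mul_bdd (c := ‖g‖)
      (g.continuous.comp (continuous_const.sub Φ.continuous)).measurable.aestronglyMeasurable
      (ae_of_all _ fun y => g.norm_coe_le_norm _)
  rw [← integral_const_mul, ← integral_sub h1 (hw.const_mul _), deathDeriv, η.integral_eq,
    Config.integral_toMeasure, Config.integral_toMeasure]
  refine tsum_congr fun y => ?_
  rw [deathGrad_eq hF η y.2]
  change (y.1.1 : ℝ) * (_ * h y.1.2) = (y.1.1 : ℝ) * h y.1.2 * _ - _ * ((y.1.1 : ℝ) * h y.1.2)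
  ring

variable {ν : Measure Weight} [IsLocallyFiniteMeasure ν]
  {σ : Measure X} [IsLocallyFiniteMeasure σ] [NullSingletonClass σ]

/-- The formula can fail only over the atoms of `η`, and these positions are negligible because `σ`
has no atoms. -/
theorem ae_birthGrad_mul_eq (hF : ∀ η : Cone X, F η = g (∫ y, Φ y ∂η.toConfig.toMeasure))
    (h : C_c(X, ℝ)) (η : Cone X) : ∀ᵐ y ∂(ν.prod σ), birthGrad F η y * (y.1 : ℝ) * h y.2 =
      weightMul h y * (g (∫ z, Φ z ∂η.toConfig.toMeasure + Φ y) -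
        g (∫ z, Φ z ∂η.toConfig.toMeasure)) := by
  filter_upwards [Measure.quasiMeasurePreserving_snd.ae (η.ae_apply_singleton_eq_zero σ)] with y hy
  rw [birthGrad_eq hF η hy]
  change _ = (y.1 : ℝ) * h y.2 * _
  ring

theorem integrable_weightMul_mul_sub (hν : Integrable (fun s : Weight => (s : ℝ)) ν)
    (h : C_c(X, ℝ)) (P : Fin N → ℝ) :
    Integrable (fun y => weightMul h y * (g (P + Φ y) - g P)) (ν.prod σ) :=
  (integrable_weightMul hν h).mul_bdd (c := 2 * ‖g‖)
    ((g.continuous.comp (continuous_const.add Φ.continuous)).sub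
      continuous_const).measurable.aestronglyMeasurable
    (ae_of_all _ fun y => (norm_sub_le _ _).trans (by
      rw [two_mul]; exact add_le_add (g.norm_coe_le_norm _) (g.norm_coe_le_norm _)))

theorem integrable_birthGrad_mul (hν : Integrable (fun s : Weight => (s : ℝ)) ν)
    (hF : ∀ η : Cone X, F η = g (∫ y, Φ y ∂η.toConfig.toMeasure)) (h : C_c(X, ℝ)) (η : Cone X) :
    Integrable (fun y : Marked X => birthGrad F η y * (y.1 : ℝ) * h y.2) (ν.prod σ) :=
  (integrable_congr (ae_birthGrad_mul_eq hF h η)).2 (integrable_weightMul_mul_sub hν h _)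

theorem birthDeriv_eq (hν : Integrable (fun s : Weight => (s : ℝ)) ν)
    (hF : ∀ η : Cone X, F η = g (∫ y, Φ y ∂η.toConfig.toMeasure)) (h : C_c(X, ℝ)) (η : Cone X) :
    birthDeriv ν σ h F η =
      ∫ y, weightMul h y * g (∫ z, Φ z ∂η.toConfig.toMeasure + Φ y) ∂(ν.prod σ) -
      g (∫ z, Φ z ∂η.toConfig.toMeasure) * ∫ y, weightMul h y ∂(ν.prod σ) := by
  set P := ∫ z, Φ z ∂η.toConfig.toMeasure
  have hw : Integrable (weightMul h) (ν.prod σ) := integrable_weightMul hν h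
  have h1 : Integrable (fun y => weightMul h y * g (P + Φ y)) (ν.prod σ) :=
    hw.mul_bdd (c := ‖g‖)
      (g.continuous.comp (continuous_const.add Φ.continuous)).measurable.aestronglyMeasurable
      (ae_of_all _ fun y => g.norm_coe_le_norm _)
  rw [← integral_const_mul, ← integral_sub h1 (hw.const_mul _), birthDeriv]
  simp_rw [← integral_mul_const]
  rw [← integral_prod_symm (fun y : Marked X => birthGrad F η y * (y.1 : ℝ) * h y.2)
    (integrable_birthGrad_mul hν hF h η), integral_congr_ae (ae_birthGrad_mul_eq hF h η)]
  refine integral_congr_ae (ae_of_all _ fun y => ?_)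
  ring

theorem multTerm_eq (h : C_c(X, ℝ)) (η : Cone X) :
    multTerm ν σ h η = ∫ y, weightMul h y ∂η.toConfig.toMeasure -
      ∫ y, weightMul h y ∂(ν.prod σ) := by
  rw [multTerm, η.integral_eq, ← integral_prod_mul]
  rfl

theorem integral_parts (hν : Integrable (fun s : Weight => (s : ℝ)) ν)
    {π : Measure (Config X)} (hπ : IsPoisson (ν.prod σ) π) {G : Cone X → ℝ} {N' : ℕ}
    {g' : (Fin N' → ℝ) →ᵇ ℝ} {Φ' : C_c(Marked X, Fin N' → ℝ)}
    (hF : ∀ η : Cone X, F η = g (∫ y, Φ y ∂η.toConfig.toMeasure))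
    (hG : ∀ η : Cone X, G η = g' (∫ y, Φ' y ∂η.toConfig.toMeasure)) (h : C_c(X, ℝ)) :
    Integrable (fun η => deathDeriv h F η * G η) (coneMeasure π) ∧
    Integrable (fun η => F η * birthDeriv ν σ h G η) (coneMeasure π) ∧
    Integrable (fun η => F η * G η * multTerm ν σ h η) (coneMeasure π) ∧
    ∫ η, deathDeriv h F η * G η ∂(coneMeasure π) =
      ∫ η, F η * birthDeriv ν σ h G η ∂(coneMeasure π) -
        ∫ η, F η * G η * multTerm ν σ h η ∂(coneMeasure π) := by
  have := hπ.isProbabilityMeasure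
  let w : C(Marked X, ℝ) := weightMul h
  have hw : Integrable w (ν.prod σ) := integrable_weightMul hν h
  let P : Config X → Fin N → ℝ := fun γ => ∫ z, Φ z ∂γ.toMeasure
  let P' : Config X → Fin N' → ℝ := fun γ => ∫ z, Φ' z ∂γ.toMeasure
  have hP : Measurable P := Config.measurable_integral_vector Φ
  have hP' : Measurable P' := Config.measurable_integral_vector Φ'
  let Ψ : C_c(Marked X, (Fin N → ℝ) × (Fin N' → ℝ)) := ⟨⟨fun y => (Φ y, Φ' y), by fun_prop⟩,
    HasCompactSupport.intro (Φ.hasCompactSupport.isCompact.union Φ'.hasCompactSupport.isCompact)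
      fun y hy => Prod.ext
        (image_eq_zero_of_notMem_tsupport (f := Φ) fun h => hy (Or.inl h))
        (image_eq_zero_of_notMem_tsupport (f := Φ') fun h => hy (Or.inr h))⟩
  have hΨ : ∀ γ : Config X, ∫ z, Ψ z ∂γ.toMeasure = (P γ, P' γ) := fun γ =>
    integral_pair (integrable_compactlySupported Φ γ.toMeasure)
      (integrable_compactlySupported Φ' γ.toMeasure)
  set B : ℝ := ‖g‖ * ‖g'‖
  have hB : ∀ p q, ‖g p * g' q‖ ≤ B := fun p q => by
    rw [norm_mul]
    exact mul_le_mul (g.norm_coe_le_norm _) (g'.norm_coe_le_norm _) (norm_nonneg _)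
      (norm_nonneg _)
  -- Evaluated at `Ψ`-integral minus `Ψ y`, this `K` equals `g(P - Φ y) g'(P')`; on the other side
  -- of the identity it equals `g(P) g'(P' + Φ' y)`.
  obtain ⟨hi1, he1⟩ := hπ.mecke w hw Ψ (fun p q => g p.1 * g' (p.2 + q.2))
    (by simp only [Function.uncurry_def]; fun_prop) (B := B) (fun p q => hB _ _)
  -- Adding back both components cancels the removal, which leaves integrability of `g(P) g'(P') ∫ w
  -- dγ`. This term is common to the death derivative and to `F G B`.
  obtain ⟨hi3, -⟩ := hπ.mecke w hw Ψ (fun p q => g (p.1 + q.1) * g' (p.2 + q.2))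
    (by simp only [Function.uncurry_def]; fun_prop) (B := B) (fun p q => hB _ _)
  simp only [hΨ] at hi1 he1 hi3
  have hΨ1 : ∀ y, (Ψ y).1 = Φ y := fun y => rfl
  have hΨ2 : ∀ y, (Ψ y).2 = Φ' y := fun y => rfl
  simp only [Prod.fst_sub, Prod.snd_sub, hΨ1, hΨ2, sub_add_cancel] at hi1 he1 hi3
  simp only [integral_mul_const] at hi3
  set c : ℝ := ∫ y, w y ∂(ν.prod σ)
  have hi4 : Integrable (fun γ => g (P γ) * g' (P' γ)) π :=
    Integrable.of_bound ((g.continuous.measurable.comp hP).mul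
      (g'.continuous.measurable.comp hP')).aestronglyMeasurable B (ae_of_all _ fun γ => hB _ _)
  have hjoint : Integrable (fun q : Config X × Marked X =>
      w q.2 * (g (P q.1) * g' (P' q.1 + Φ' q.2))) (π.prod (ν.prod σ)) := by
    refine (hw.comp_snd π).mul_bdd (c := B) (Measurable.aestronglyMeasurable ?_)
      (ae_of_all _ fun q => hB _ _)
    exact (g.continuous.measurable.comp (hP.comp measurable_fst)).mul
      (g'.continuous.measurable.comp ((hP'.comp measurable_fst).add
        (Φ'.continuous.measurable.comp measurable_snd)))
  have hi2 := hjoint.integral_prod_left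
  -- Fubini's theorem brings the mean of the birth term to the order of integration of the Mecke
  -- identity.
  have he2 := integral_integral_swap
    (f := fun γ y => w y * (g (P γ) * g' (P' γ + Φ' y))) hjoint
  simp_rw [integral_const_mul (w _)] at he2
  have hpin := hπ.ae_mem_pinpointing hν
  have hsymm : ∀ γ : pinpointing X, (coneEquiv X γ).toConfig = γ.1 := fun γ =>
    congrArg Subtype.val ((coneEquiv X).symm_apply_apply γ)
  obtain ⟨d1, d2⟩ := integrable_and_integral_coneMeasure hpin (hi1.sub hi3)
    (H := fun η => deathDeriv h F η * G η) fun γ => by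
      rw [deathDeriv_eq hF, hG, hsymm, sub_mul, ← integral_mul_const]
      simp only [Pi.sub_apply]
      congr 1
      · exact integral_congr_ae (ae_of_all _ fun y => mul_assoc _ _ _)
      · change g (P γ) * (∫ y, w y ∂γ.1.toMeasure) * g' (P' γ) = _
        ring
  obtain ⟨b1, b2⟩ := integrable_and_integral_coneMeasure hpin (hi2.sub (hi4.mul_const c))
    (H := fun η => F η * birthDeriv ν σ h G η) fun γ => by
      rw [birthDeriv_eq hν hG, hF, hsymm, mul_sub, ← integral_const_mul]
      simp only [Pi.sub_apply]
      congr 1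
      · exact integral_congr_ae (ae_of_all _ fun y => mul_left_comm _ _ _)
      · exact (mul_assoc _ _ _).symm
  obtain ⟨m1, m2⟩ := integrable_and_integral_coneMeasure hpin (hi3.sub (hi4.mul_const c))
    (H := fun η => F η * G η * multTerm ν σ h η) fun γ => by
      rw [multTerm_eq, hF, hG, hsymm, mul_sub]
      simp only [Pi.sub_apply]
      congr 1
      exact mul_comm _ _
  refine ⟨d1, b1, m1, ?_⟩
  rw [d2, b2, m2, integral_sub' hi1 hi3, integral_sub' hi2 (hi4.mul_const c),
    integral_sub' hi3 (hi4.mul_const c), he1, he2]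
  ring

end Derivatives

end RadonCone

theorem mainTheorem8 {X : Type*} [TopologicalSpace X] [PolishSpace X] [LocallyCompactSpace X]
    [MeasurableSpace X] [BorelSpace X]
    (ν : Measure Weight) [IsLocallyFiniteMeasure ν] [NullSingletonClass ν]
    (σ : Measure X) [IsLocallyFiniteMeasure σ] [NullSingletonClass σ]
    (hν : Integrable (fun s : Weight => (s : ℝ)) ν)
    (π : Measure (Config X)) (hπ : IsPoisson (ν.prod σ) π)
    (F G : Cone X → ℝ) (hF : IsCylinder F) (hG : IsCylinder G) (h : C_c(X, ℝ)) :
    (∀ η : Cone X, Integrable (fun x => deathGrad F η x * h x) η.1) ∧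
    (∀ η : Cone X,
      Integrable (fun y : Marked X => birthGrad G η y * (y.1 : ℝ) * h y.2) (ν.prod σ)) ∧
    Integrable (fun η => deathDeriv h F η * G η) (coneMeasure π) ∧
    Integrable (fun η => F η * birthDeriv ν σ h G η) (coneMeasure π) ∧
    Integrable (fun η => F η * G η * multTerm ν σ h η) (coneMeasure π) ∧
    ∫ η, deathDeriv h F η * G η ∂(coneMeasure π) =
      ∫ η, F η * birthDeriv ν σ h G η ∂(coneMeasure π) -
        ∫ η, F η * G η * multTerm ν σ h η ∂(coneMeasure π) := by
  obtain ⟨N, g, Φ, hF'⟩ := hF.exists_vector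
  obtain ⟨N', g', Φ', hG'⟩ := hG.exists_vector
  exact ⟨integrable_deathGrad_mul hF' h, integrable_birthGrad_mul hν hG' h,
    integral_parts hν hπ hF' hG' h⟩
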